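/- Let $d,T\ge 1$ be integers and $K>0$, let $A^\star\in\mathbb{R}^{d\times d}$ be stable (every complex eigenvalue of $A^\star$ has modulus strictly smaller than $1$), and let $W_0,\dots,W_{T-1}$ be i.i.d. random vectors in $\mathbb{R}^{d}$ that are isotropic, $\mathbf{E}\,W_tW_t^{\mathsf T}=I_d$, and $K^2$-sub-Gaussian, that is, $\mathbf{E}\exp(\langle v,W_t\rangle)\le \exp(K^2\|v\|_2^2/2)$ for every $v\in\mathbb{R}^d$. Let $X_0=0$ and $$X_{t+1}=A^\star X_t+W_t,\qquad t=0,\dots,T-1 .$$ Set $$\Gamma_T=\sum_{t=1}^{T}\sum_{k=0}^{t-1}(A^\star)^k(A^{\star\mathsf T})^k,\qquad M=\Gamma_T^{-1/2},$$ and let $\mathbf{L}\in\mathbb{R}^{Td\times Td}$ be the block lower-triangular matrix with $d\times d$ blocks $\mathbf{L}_{ts}=(A^\star)^{t-s}$ for $s\le t$ and $\mathbf{L}_{ts}=0$ for $s>t$, so that $(X_1,\dots,X_T)=\mathbf{L}\,(W_0,\dots,W_{T-1})$ as stacked vectors. Then for every $\varepsilon>0$, with probability at least $$1-\exp\left(-\frac{\varepsilon^2}{576\,K^4\,\|M\|_{\mathrm{op}}^2\,\|\mathbf{L}\|_{\mathrm{op}}^2}+d\log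 18\right),$$ the following holds simultaneously for every $i\in\{1,\dots,d\}$: $$\max(1-\varepsilon,0)^2\,\lambda_{\min}(\Gamma_T)\;\le\;\lambda_i\left(\sum_{t=1}^{T}X_tX_t^{\mathsf T}\right)\;\le\;(1+\varepsilon)^2\,\lambda_{\max}(\Gamma_T).$$ Here $\|\cdot\|_{\mathrm{op}}$ is the operator norm with respect to the Euclidean norm and $\lambda_1,\dots,\lambda_d$ are the eigenvalues of a symmetric matrix. -/

import Mathlib

open MeasureTheory ProbabilityTheory

noncomputable section

/-- A random vector `W` in `ℝ^d` is `σ2`-sub-Gaussian (`σ2` is the variance proxy): its moment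
generating function exists everywhere and `E exp ⟨v, W⟩ ≤ exp (σ2 ‖v‖² / 2)` for every `v`. -/
def IsSubGaussianVector {Ω : Type*} [MeasurableSpace Ω] {d : ℕ}
    (W : Ω → EuclideanSpace ℝ (Fin d)) (σ2 : ℝ) (μ : Measure Ω) : Prop :=
  ∀ v : EuclideanSpace ℝ (Fin d),
    Integrable (fun ω => Real.exp (inner ℝ v (W ω))) μ ∧
      ∫ ω, Real.exp (inner ℝ v (W ω)) ∂μ ≤ Real.exp (σ2 * ‖v‖ ^ 2 / 2)

/-- A random vector `W` in `ℝ^d` is isotropic: `E [W Wᵀ] = I`. -/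
def IsIsotropicVector {Ω : Type*} [MeasurableSpace Ω] {d : ℕ}
    (W : Ω → EuclideanSpace ℝ (Fin d)) (μ : Measure Ω) : Prop :=
  ∀ i j : Fin d, Integrable (fun ω => W ω i * W ω j) μ ∧
    ∫ ω, W ω i * W ω j ∂μ = (1 : Matrix (Fin d) (Fin d) ℝ) i j

/-- All complex eigenvalues of the real matrix `A` have modulus strictly smaller than one. -/
def IsStableMatrix {d : ℕ} (A : Matrix (Fin d) (Fin d) ℝ) : Prop :=
  ∀ z ∈ spectrum ℂ (A.map (fun x : ℝ => (x : ℂ))), ‖z‖ < 1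

/-- The operator norm of a square matrix with respect to the Euclidean norm. -/
def euclideanOpNorm {n : Type*} [Fintype n] [DecidableEq n] (A : Matrix n n ℝ) : ℝ :=
  ‖Matrix.toEuclideanCLM (n := n) (𝕜 := ℝ) A‖

/-- The smallest eigenvalue of a symmetric matrix. -/
def lambdaMin {n : Type*} [Fintype n] [DecidableEq n] {A : Matrix n n ℝ}
    (hA : A.IsHermitian) : ℝ := ⨅ i, hA.eigenvalues i

/-- The largest eigenvalue of a symmetric matrix. -/
def lambdaMax {n : Type*} [Fintype n] [DecidableEq n] {A : Matrix n n ℝ}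
    (hA : A.IsHermitian) : ℝ := ⨆ i, hA.eigenvalues i

/-- The matrix `Γ_T = ∑_{t=1}^T ∑_{k=0}^{t-1} A^k (Aᵀ)^k`. -/
def gammaMatrix {d : ℕ} (A : Matrix (Fin d) (Fin d) ℝ) (T : ℕ) : Matrix (Fin d) (Fin d) ℝ :=
  ∑ t ∈ Finset.Icc 1 T, ∑ k ∈ Finset.range t, A ^ k * A.transpose ^ k

theorem gammaMatrix_isHermitian {d : ℕ} (A : Matrix (Fin d) (Fin d) ℝ) (T : ℕ) :
    (gammaMatrix A T).IsHermitian := by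
  simp [Matrix.IsHermitian, gammaMatrix, Matrix.conjTranspose_eq_transpose_of_trivial,
    Matrix.transpose_sum, Matrix.transpose_mul, Matrix.transpose_pow]

/-- The matrix `M = Γ_T^{-1/2}`, through the functional calculus of symmetric matrices. -/
def invSqrtGamma {d : ℕ} (A : Matrix (Fin d) (Fin d) ℝ) (T : ℕ) : Matrix (Fin d) (Fin d) ℝ :=
  cfc (fun x : ℝ => x ^ (-(1 / 2) : ℝ)) (gammaMatrix A T)

/-- The block lower-triangular Toeplitz matrix `L`, with blocks `A^{t-s}` for `s ≤ t`, that maps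
the stacked noise `(W_0, …, W_{T-1})` to the stacked states `(X_1, …, X_T)`. -/
def noiseToState {d : ℕ} (A : Matrix (Fin d) (Fin d) ℝ) (T : ℕ) :
    Matrix (Fin T × Fin d) (Fin T × Fin d) ℝ :=
  fun p q => if q.1 ≤ p.1 then (A ^ ((p.1 : ℕ) - (q.1 : ℕ))) p.2 q.2 else 0

/-- The unnormalized empirical covariance matrix `∑_{t=1}^T x_t x_tᵀ` of a trajectory. -/
def empiricalGram {d : ℕ} (x : ℕ → EuclideanSpace ℝ (Fin d)) (T : ℕ) :
    Matrix (Fin d) (Fin d) ℝ :=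
  ∑ t ∈ Finset.Icc 1 T, Matrix.vecMulVec (x t).ofLp (x t).ofLp

theorem empiricalGram_isHermitian {d : ℕ} (x : ℕ → EuclideanSpace ℝ (Fin d)) (T : ℕ) :
    (empiricalGram x T).IsHermitian := by
  simp [Matrix.IsHermitian, empiricalGram, Matrix.conjTranspose_eq_transpose_of_trivial,
    Matrix.transpose_sum, Matrix.transpose_vecMulVec]

end

/-! Normalise by `M` = Γ^{-1/2}. For a unit vector u, the form Q(u) = ∑_t ⟨Mu, X_t⟩² is a squared
norm of a linear image of the noise, ∑_t (∑_s ⟨b_ts, W_s⟩)², and its mean is uᵀMΓMu = 1. The core is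
a Hanson–Wright bound with explicit constants: |Q(u) - 1| reaches max(ε, ε²)/2 with probability at
most 2 exp(-ε²/(576 K⁴ N)), where N = ‖M‖²‖L‖². A quarter-net of the sphere has at most 9^d points,
passing from net to sphere doubles the error, and the union bound costs 2·9^d ≤ 18^d. Off the bad
event the forms of ∑ X_t X_tᵀ and Γ agree up to relative error max(ε, ε²), and the eigenvalue bounds
follow.

For the exponential moment behind the tail (`lintegral_exp_centered_sum_sq_le`), convexity separates
diagonal terms, where one noise vector occurs twice, from off-diagonal ones. The diagonal is a sum
of independent centered blocks, each controlled by a second-order expansion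
(`lintegral_exp_centered_block_le`). The off-diagonal part is four times the average, over subsets I
of the indices, of the terms pairing I with its complement. Jensen reduces it to one fixed I, and
integrating out the noise in I leaves the exponential of a squared norm
(`lintegral_exp_decoupled_le`). That is bounded by writing exp(s y²) as a Gaussian average of
exp(√(2s) y g), to which the sub-Gaussian hypothesis applies (`lintegral_exp_sum_sq_le`). -/

/-! ### Gaussian linearisation of squares. -/

theorem lintegral_exp_mul_gaussianReal (a : ℝ) :
    ∫⁻ x, ENNReal.ofReal (Real.exp (a * x)) ∂(gaussianReal 0 1) =
      ENNReal.ofReal (Real.exp (a ^ 2 / 2)) := by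
  rw [← ofReal_integral_eq_lintegral_ofReal (integrable_exp_mul_gaussianReal a)
    (Filter.Eventually.of_forall fun x => (Real.exp_pos _).le)]
  have h := congrFun (mgf_id_gaussianReal (μ := 0) (v := 1)) a
  simp only [mgf, id] at h
  rw [h]
  simp

theorem lintegral_exp_mul_sq_gaussianReal {c : ℝ} (hc : 2 * c < 1) :
    ∫⁻ x, ENNReal.ofReal (Real.exp (c * x ^ 2)) ∂(gaussianReal 0 1) =
      ENNReal.ofReal (√(1 - 2 * c))⁻¹ := by
  have hb : 0 < 1 / 2 - c := by linarith
  have hpt : ∀ x : ℝ, gaussianPDF 0 1 x * ENNReal.ofReal (Real.exp (c * x ^ 2)) =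
      ENNReal.ofReal ((√(2 * Real.pi))⁻¹ * Real.exp (-(1 / 2 - c) * x ^ 2)) := fun x => by
    rw [gaussianPDF, gaussianPDFReal, ← ENNReal.ofReal_mul (by positivity), mul_assoc,
      ← Real.exp_add]
    congr 2
    · simp
    · congr 1; simp; ring
  rw [gaussianReal_of_var_ne_zero _ one_ne_zero, lintegral_withDensity_eq_lintegral_mul _
    (measurable_gaussianPDF 0 1) (by fun_prop)]
  simp only [Pi.mul_apply, hpt]
  rw [← ofReal_integral_eq_lintegral_ofReal ((integrable_exp_neg_mul_sq hb).const_mul _)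
    (Filter.Eventually.of_forall fun x => by positivity), integral_const_mul, integral_gaussian,
    ← Real.sqrt_inv, ← Real.sqrt_mul (by positivity), ← Real.sqrt_inv]
  congr 2
  field_simp

theorem lintegral_pi_prod_eq_prod {ι : Type*} [Fintype ι] (ν : Measure ℝ) [IsProbabilityMeasure ν]
    {f : ι → ℝ → ENNReal} (hf : ∀ i, Measurable (f i)) :
    ∫⁻ g, ∏ i, f i (g i) ∂(Measure.pi fun _ : ι => ν) = ∏ i, ∫⁻ x, f i x ∂ν := by
  rw [lintegral_prod_eq_prod_lintegral_of_indepFun Finset.univ (fun i (g : ι → ℝ) => f i (g i))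
    (iIndepFun_pi fun i => (hf i).aemeasurable) (fun i => (hf i).comp (measurable_pi_apply i))]
  refine Finset.prod_congr rfl fun i _ => ?_
  exact (measurePreserving_eval (fun _ : ι => ν) i).lintegral_comp (hf i)

/-- If the vector `Y` has Gaussian-type exponential moments with diagonal covariance `γ`, then the
exponential moment of its squared norm is at most that of the corresponding Gaussian vector. -/
theorem lintegral_exp_sum_sq_le {Ω ι : Type*} [MeasurableSpace Ω] {μ : Measure Ω} [SFinite μ]
    [Fintype ι] {Y : ι → Ω → ℝ} (hY : ∀ i, Measurable (Y i)) {γ : ι → ℝ} {s : ℝ} (hs : 0 ≤ s)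
    (hγ : ∀ i, 2 * (s * γ i) < 1)
    (h : ∀ g : ι → ℝ, ∫⁻ ω, ENNReal.ofReal (Real.exp (∑ i, g i * Y i ω)) ∂μ ≤
      ENNReal.ofReal (Real.exp (∑ i, γ i * g i ^ 2 / 2))) :
    ∫⁻ ω, ENNReal.ofReal (Real.exp (s * ∑ i, Y i ω ^ 2)) ∂μ ≤
      ENNReal.ofReal (∏ i, (√(1 - 2 * (s * γ i)))⁻¹) := by
  set P : Measure (ι → ℝ) := Measure.pi fun _ : ι => gaussianReal 0 1
  have hexp : ∀ (c : ι → ℝ), ENNReal.ofReal (Real.exp (∑ i, c i)) =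
      ∏ i, ENNReal.ofReal (Real.exp (c i)) := fun c => by
    rw [Real.exp_sum, ENNReal.ofReal_prod_of_nonneg fun i _ => (Real.exp_pos _).le]
  -- Independent standard Gaussians g linearise the square: exp(s y²) = E exp(√(2s) y g). After
  -- Tonelli the hypothesis is used at √(2s) g for frozen g, and only Gaussian integrals of exp(s γ
  -- g²) remain.
  have hpt : ∀ ω, ENNReal.ofReal (Real.exp (s * ∑ i, Y i ω ^ 2)) =
      ∫⁻ g, ENNReal.ofReal (Real.exp (∑ i, √(2 * s) * Y i ω * g i)) ∂P := fun ω => by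
    simp_rw [hexp]
    rw [lintegral_pi_prod_eq_prod _ (f := fun i x => ENNReal.ofReal (Real.exp (√(2 * s) * Y i ω * x)))
      (fun i => by fun_prop)]
    simp_rw [lintegral_exp_mul_gaussianReal]
    rw [Finset.mul_sum, hexp]
    refine Finset.prod_congr rfl fun i _ => ?_
    rw [mul_pow, Real.sq_sqrt (by positivity)]
    congr 2; ring
  simp_rw [hpt]
  rw [lintegral_lintegral_swap (by fun_prop)]
  calc ∫⁻ g, ∫⁻ ω, ENNReal.ofReal (Real.exp (∑ i, √(2 * s) * Y i ω * g i)) ∂μ ∂P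
      ≤ ∫⁻ g, ∏ i, ENNReal.ofReal (Real.exp (s * γ i * g i ^ 2)) ∂P := by
        refine lintegral_mono fun g => ?_
        rw [← hexp]
        convert h (fun i => √(2 * s) * g i) using 1
        · refine lintegral_congr fun ω => congrArg _ (congrArg _ (Finset.sum_congr rfl fun i _ => by ring))
        · refine congrArg _ (congrArg _ (Finset.sum_congr rfl fun i _ => ?_))
          rw [mul_pow, Real.sq_sqrt (by positivity)]; ring
    _ = ∏ i, ENNReal.ofReal (√(1 - 2 * (s * γ i)))⁻¹ := by
        rw [lintegral_pi_prod_eq_prod _ (f := fun i x => ENNReal.ofReal (Real.exp (s * γ i * x ^ 2)))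
          (fun i => by fun_prop)]
        exact Finset.prod_congr rfl fun i _ => lintegral_exp_mul_sq_gaussianReal (hγ i)
    _ = _ := (ENNReal.ofReal_prod_of_nonneg fun i _ => by positivity).symm

/-! ### Elementary exponential inequalities. -/

theorem ofReal_exp_sum {ι : Type*} (s : Finset ι) (c : ι → ℝ) :
    ENNReal.ofReal (Real.exp (∑ i ∈ s, c i)) = ∏ i ∈ s, ENNReal.ofReal (Real.exp (c i)) := by
  rw [Real.exp_sum, ENNReal.ofReal_prod_of_nonneg fun i _ => (Real.exp_pos _).le]

theorem Real.exp_sub_one_sub_id_le {y : ℝ} (hy : 0 ≤ y) :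
    Real.exp y - 1 - y ≤ y ^ 2 / 2 * Real.exp y := by
  -- After multiplication by exp(-y) the claim says that this function is at least its value 1 at
  -- the origin.
  have hd : ∀ x : ℝ, HasDerivAt (fun x => x ^ 2 / 2 + (1 + x) * Real.exp (-x))
      (x * (1 - Real.exp (-x))) x := fun x => by
    have h1 := ((hasDerivAt_id x).pow 2).div_const 2
    have h2 := ((hasDerivAt_id x).const_add 1).mul (hasDerivAt_id x).neg.exp
    refine (h1.add h2).congr_deriv ?_
    simp only [id, Pi.neg_apply]
    ring
  have hm : MonotoneOn (fun x : ℝ => x ^ 2 / 2 + (1 + x) * Real.exp (-x)) (Set.Ici 0) := by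
    refine monotoneOn_of_deriv_nonneg (convex_Ici 0) (by fun_prop)
      (fun x _ => (hd x).differentiableAt.differentiableWithinAt) fun x hx => ?_
    rw [interior_Ici, Set.mem_Ioi] at hx
    rw [(hd x).deriv]
    have : Real.exp (-x) ≤ 1 := Real.exp_le_one_iff.mpr (by linarith)
    exact mul_nonneg hx.le (by linarith)
  have h := hm Set.self_mem_Ici hy hy
  simp only [Real.exp_neg] at h
  norm_num at h
  have hpos := Real.exp_pos y
  have h2 := mul_le_mul_of_nonneg_right h hpos.le
  rw [add_mul, mul_assoc (1 + y), inv_mul_cancel₀ hpos.ne'] at h2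
  linarith

theorem Real.exp_le_one_add_add_sq_mul_exp_abs (x : ℝ) :
    Real.exp x ≤ 1 + x + x ^ 2 / 2 * Real.exp |x| := by
  have h := Complex.norm_exp_sub_sum_le_exp_norm_sub_sum (x : ℂ) 2
  simp only [Finset.sum_range_succ, Finset.sum_range_zero, Complex.norm_real] at h
  norm_num at h
  norm_cast at h
  have h2 := (abs_le.mp h).2
  rw [← sq_abs]
  have h3 := Real.exp_sub_one_sub_id_le (abs_nonneg x)
  linarith

/-- The Taylor remainder uses only exp(S/18) of the available exp S; the other factor exp(17S/18)
absorbs S². Keeping the linear term exact is what later allows centering. -/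
theorem exp_mul_le_one_add_add_sq_mul_exp {η S : ℝ} (hη : |η| ≤ 1 / 18) (hS : 0 ≤ S) :
    Real.exp (η * S) ≤ 1 + η * S + η ^ 2 / 3 * Real.exp S := by
  have h1 := Real.exp_le_one_add_add_sq_mul_exp_abs (η * S)
  have h2 : Real.exp |η * S| ≤ Real.exp (S / 18) := by
    apply Real.exp_le_exp.mpr
    rw [abs_mul, abs_of_nonneg hS]
    nlinarith
  -- Square e·x ≤ exp x at x = 17S/36; with 2.7 < e, the coefficient (2.7·17/36)² exceeds 3/2.
  have h3 : S ^ 2 ≤ 2 / 3 * Real.exp (17 * S / 18) := by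
    have h4 : 17 * S / 36 ≤ Real.exp (17 * S / 36 - 1) := by
      have := Real.add_one_le_exp (17 * S / 36 - 1); linarith
    have h5 : 2.7 * (17 * S / 36) ≤ Real.exp (17 * S / 36) := by
      have h6 := Real.exp_one_gt_d9
      have h7 : Real.exp (17 * S / 36) = Real.exp 1 * Real.exp (17 * S / 36 - 1) := by
        rw [← Real.exp_add]; ring_nf
      rw [h7]
      exact mul_le_mul (by linarith) h4 (by positivity) (by positivity)
    have h8 : Real.exp (17 * S / 18) = Real.exp (17 * S / 36) ^ 2 := by
      rw [← Real.exp_nat_mul]; congr 1; push_cast; ring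
    have h9 : (2.7 * (17 * S / 36)) ^ 2 ≤ Real.exp (17 * S / 36) ^ 2 :=
      pow_le_pow_left₀ (by positivity) h5 2
    rw [h8]
    nlinarith [sq_nonneg S]
  have h4 : Real.exp S = Real.exp (17 * S / 18) * Real.exp (S / 18) := by
    rw [← Real.exp_add]; ring_nf
  calc Real.exp (η * S) ≤ 1 + η * S + (η * S) ^ 2 / 2 * Real.exp |η * S| := h1
    _ ≤ 1 + η * S + (η * S) ^ 2 / 2 * Real.exp (S / 18) := by gcongr
    _ = 1 + η * S + η ^ 2 / 2 * (S ^ 2 * Real.exp (S / 18)) := by ring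
    _ ≤ 1 + η * S + η ^ 2 / 2 * ((2 / 3 * Real.exp (17 * S / 18)) * Real.exp (S / 18)) := by
        gcongr
    _ = _ := by rw [h4]; ring

/-! ### Diagonal part: independent centered blocks. -/

section CenteredBlocks

variable {Ω : Type*} [MeasurableSpace Ω] {μ : Measure Ω} {d : ℕ}

theorem IsSubGaussianVector.lintegral_exp_inner_le {w : Ω → EuclideanSpace ℝ (Fin d)} {κ : ℝ}
    (hw : IsSubGaussianVector w κ μ) (v : EuclideanSpace ℝ (Fin d)) :
    ∫⁻ ω, ENNReal.ofReal (Real.exp (inner ℝ v (w ω))) ∂μ ≤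
      ENNReal.ofReal (Real.exp (κ * ‖v‖ ^ 2 / 2)) := by
  rw [← ofReal_integral_eq_lintegral_ofReal (hw v).1
    (Filter.Eventually.of_forall fun x => (Real.exp_pos _).le)]
  exact ENNReal.ofReal_le_ofReal (hw v).2

theorem lintegral_exp_sum_inner_le {ι : Type*} [Fintype ι]
    {W : ι → Ω → EuclideanSpace ℝ (Fin d)} {κ : ℝ} (hmeas : ∀ i, Measurable (W i))
    (hindep : iIndepFun W μ) (hsub : ∀ i, IsSubGaussianVector (W i) κ μ)
    (h : ι → EuclideanSpace ℝ (Fin d)) :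
    ∫⁻ ω, ENNReal.ofReal (Real.exp (∑ i, inner ℝ (h i) (W i ω))) ∂μ ≤
      ENNReal.ofReal (Real.exp (κ / 2 * ∑ i, ‖h i‖ ^ 2)) := by
  simp_rw [Finset.mul_sum, ofReal_exp_sum]
  rw [lintegral_prod_eq_prod_lintegral_of_indepFun Finset.univ
    (fun i ω => ENNReal.ofReal (Real.exp (inner ℝ (h i) (W i ω))))
    (hindep.comp (fun i x => ENNReal.ofReal (Real.exp (inner ℝ (h i) x))) fun i => by fun_prop)
    (fun i => by have := hmeas i; fun_prop)]
  refine Finset.prod_le_prod' fun i _ => ?_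
  refine ((hsub i).lintegral_exp_inner_le (h i)).trans (le_of_eq ?_)
  ring_nf

/-- Gaussian comparison in dimension one: at s = 1/(4κ) the factor (1 - 2sκ)^{-1/2} is √2. -/
theorem IsSubGaussianVector.lintegral_exp_inner_sq_le [SFinite μ]
    {w : Ω → EuclideanSpace ℝ (Fin d)} {κ : ℝ} (hmeas : Measurable w) (hκ : 0 < κ)
    (hw : IsSubGaussianVector w κ μ) {u : EuclideanSpace ℝ (Fin d)} (hu : ‖u‖ ≤ 1) :
    ∫⁻ ω, ENNReal.ofReal (Real.exp (inner ℝ u (w ω) ^ 2 / (4 * κ))) ∂μ ≤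
      ENNReal.ofReal √2 := by
  have h := lintegral_exp_sum_sq_le (μ := μ) (ι := Unit) (Y := fun _ ω => inner ℝ u (w ω))
    (γ := fun _ => κ) (s := 1 / (4 * κ)) (fun _ => by fun_prop) (by positivity)
    (fun _ => by field_simp; norm_num) (fun g => by
      refine le_trans (le_of_eq ?_) ((hw.lintegral_exp_inner_le (g () • u)).trans ?_)
      · simp [inner_smul_left]
      · apply ENNReal.ofReal_le_ofReal
        simp only [Finset.univ_unique, Finset.sum_singleton, norm_smul, mul_pow, Real.norm_eq_abs,
          sq_abs, PUnit.default_eq_unit]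
        gcongr
        have : ‖u‖ ^ 2 ≤ 1 := pow_le_one₀ (norm_nonneg _) hu
        nlinarith [sq_nonneg (g ())])
  simp only [Finset.univ_unique, Finset.sum_singleton, Finset.prod_singleton] at h
  convert h using 3
  · congr 2; ring
  · rw [show 1 - 2 * (1 / (4 * κ) * κ) = (2 : ℝ)⁻¹ by field_simp; norm_num, Real.sqrt_inv, inv_inv]

/-- Jensen with weights ‖b_t‖²/∑‖b_t‖² reduces the sum to single normalised directions, so the
dependence between the inner products costs nothing. -/
theorem IsSubGaussianVector.lintegral_exp_sum_inner_sq_le [SFinite μ] {τ : Type*} [Fintype τ]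
    {w : Ω → EuclideanSpace ℝ (Fin d)} {κ : ℝ} (hmeas : Measurable w) (hκ : 0 < κ)
    (hw : IsSubGaussianVector w κ μ) {b : τ → EuclideanSpace ℝ (Fin d)}
    (hb : 0 < ∑ t, ‖b t‖ ^ 2) :
    ∫⁻ ω, ENNReal.ofReal (Real.exp ((∑ t, inner ℝ (b t) (w ω) ^ 2) /
      (4 * κ * ∑ t, ‖b t‖ ^ 2))) ∂μ ≤ ENNReal.ofReal √2 := by
  set τ2 := ∑ t, ‖b t‖ ^ 2 with hτ
  have hsum : ∑ t, ‖b t‖ ^ 2 / τ2 = 1 := by rw [← Finset.sum_div, div_self hb.ne']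
  calc ∫⁻ ω, ENNReal.ofReal (Real.exp ((∑ t, inner ℝ (b t) (w ω) ^ 2) / (4 * κ * τ2))) ∂μ
      ≤ ∫⁻ ω, ∑ t, ENNReal.ofReal (‖b t‖ ^ 2 / τ2) *
          ENNReal.ofReal (Real.exp (inner ℝ (‖b t‖⁻¹ • b t) (w ω) ^ 2 / (4 * κ))) ∂μ := by
        refine lintegral_mono fun ω => ?_
        simp_rw [← ENNReal.ofReal_mul (show 0 ≤ ‖b _‖ ^ 2 / τ2 by positivity)]
        rw [← ENNReal.ofReal_sum_of_nonneg fun t _ => by positivity]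
        apply ENNReal.ofReal_le_ofReal
        refine le_trans (le_of_eq ?_) (convexOn_exp.map_sum_le
          (fun t _ => by positivity) hsum (fun t _ => Set.mem_univ _))
        congr 1
        rw [Finset.sum_div]
        refine Finset.sum_congr rfl fun t _ => ?_
        -- For b t = 0 the normalised vector is 0 as well, which is why the one-direction bound is
        -- stated for ‖u‖ ≤ 1.
        rcases eq_or_ne (b t) 0 with h0 | h0
        · simp [h0]
        · have : ‖b t‖ ≠ 0 := norm_ne_zero_iff.mpr h0
          simp only [real_inner_smul_left, smul_eq_mul]
          field_simp
    _ = ∑ t, ENNReal.ofReal (‖b t‖ ^ 2 / τ2) * ∫⁻ ω,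
          ENNReal.ofReal (Real.exp (inner ℝ (‖b t‖⁻¹ • b t) (w ω) ^ 2 / (4 * κ))) ∂μ := by
        rw [lintegral_finsetSum _ fun t _ => by fun_prop]
        exact Finset.sum_congr rfl fun t _ => lintegral_const_mul _ (by fun_prop)
    _ ≤ ∑ t, ENNReal.ofReal (‖b t‖ ^ 2 / τ2) * ENNReal.ofReal √2 := by
        gcongr with t
        refine hw.lintegral_exp_inner_sq_le hmeas hκ ?_
        rw [norm_smul, norm_inv, norm_norm]
        exact inv_mul_le_one
    _ = ENNReal.ofReal √2 := by
        rw [← Finset.sum_mul, ← ENNReal.ofReal_sum_of_nonneg fun t _ => by positivity, hsum,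
          ENNReal.ofReal_one, one_mul]

theorem IsIsotropicVector.integral_inner_sq {w : Ω → EuclideanSpace ℝ (Fin d)}
    (hw : IsIsotropicVector w μ) (b : EuclideanSpace ℝ (Fin d)) :
    Integrable (fun ω => inner ℝ b (w ω) ^ 2) μ ∧ ∫ ω, inner ℝ b (w ω) ^ 2 ∂μ = ‖b‖ ^ 2 := by
  have hpt : ∀ ω, inner ℝ b (w ω) ^ 2 = ∑ i, ∑ j, b i * b j * (w ω i * w ω j) := fun ω => by
    rw [PiLp.inner_apply, sq, Finset.sum_mul_sum]
    refine Finset.sum_congr rfl fun i _ => Finset.sum_congr rfl fun j _ => ?_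
    simp only [RCLike.inner_apply, conj_trivial]; ring
  simp_rw [hpt]
  have hint : ∀ i j, Integrable (fun ω => b i * b j * (w ω i * w ω j)) μ :=
    fun i j => (hw i j).1.const_mul _
  refine ⟨integrable_finsetSum _ fun i _ => integrable_finsetSum _ fun j _ => hint i j, ?_⟩
  rw [integral_finsetSum _ fun i _ => integrable_finsetSum _ fun j _ => hint i j,
    EuclideanSpace.real_norm_sq_eq]
  refine Finset.sum_congr rfl fun i _ => ?_
  rw [integral_finsetSum _ fun j _ => hint i j]
  simp_rw [integral_const_mul, (hw i _).2, Matrix.one_apply]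
  simp [sq]

/-- Expand exp(θq) to second order with S = q/(4κτ2) and η = 4θκτ2; the condition on θ is exactly
|η| ≤ 1/18. Isotropy makes the linear term θτ2, which exp(-θτ2) cancels after 1 + x ≤ exp x. -/
theorem lintegral_exp_centered_block_le [IsProbabilityMeasure μ] {τ : Type*} [Fintype τ]
    {w : Ω → EuclideanSpace ℝ (Fin d)} {κ : ℝ} (hmeas : Measurable w) (hκ : 0 < κ)
    (hw : IsSubGaussianVector w κ μ) (hiso : IsIsotropicVector w μ)
    (b : τ → EuclideanSpace ℝ (Fin d)) {θ : ℝ} (hθ : |θ| * κ * ∑ t, ‖b t‖ ^ 2 ≤ 1 / 72) :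
    ∫⁻ ω, ENNReal.ofReal (Real.exp (θ * (∑ t, inner ℝ (b t) (w ω) ^ 2 - ∑ t, ‖b t‖ ^ 2))) ∂μ ≤
      ENNReal.ofReal (Real.exp (9 * θ ^ 2 * κ ^ 2 * (∑ t, ‖b t‖ ^ 2) ^ 2)) := by
  set τ2 := ∑ t, ‖b t‖ ^ 2 with hτ
  have hτ0 : 0 ≤ τ2 := by positivity
  rcases hτ0.eq_or_lt with h0 | hpos
  · have hb : ∀ t, b t = 0 := fun t => by
      have := (Finset.sum_eq_zero_iff_of_nonneg (fun t _ => by positivity)).mp h0.symm t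
        (Finset.mem_univ t)
      simpa using this
    simp [← h0, hb]
  set q : Ω → ℝ := fun ω => ∑ t, inner ℝ (b t) (w ω) ^ 2 with hq
  set S : Ω → ℝ := fun ω => q ω / (4 * κ * τ2) with hS
  have hqi : Integrable q μ := integrable_finsetSum _ fun t _ => (hiso.integral_inner_sq (b t)).1
  have hqE : ∫ ω, q ω ∂μ = τ2 := by
    rw [integral_finsetSum _ fun t _ => (hiso.integral_inner_sq (b t)).1]
    exact Finset.sum_congr rfl fun t _ => (hiso.integral_inner_sq (b t)).2
  have hSl := hw.lintegral_exp_sum_inner_sq_le hmeas hκ hpos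
  have hSi : Integrable (fun ω => Real.exp (S ω)) μ := by
    refine ⟨by fun_prop, ?_⟩
    rw [hasFiniteIntegral_iff_ofReal (Filter.Eventually.of_forall fun x => (Real.exp_pos _).le)]
    exact hSl.trans_lt ENNReal.ofReal_lt_top
  have hSE : ∫ ω, Real.exp (S ω) ∂μ ≤ √2 := by
    rw [integral_eq_lintegral_of_nonneg_ae
      (Filter.Eventually.of_forall fun x => (Real.exp_pos _).le) hSi.1]
    exact ENNReal.toReal_le_of_le_ofReal (by positivity) hSl
  have hη : |θ * (4 * κ * τ2)| ≤ 1 / 18 := by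
    rw [abs_mul, abs_of_pos (show 0 < 4 * κ * τ2 by positivity)]; linarith
  have hpt : ∀ ω, Real.exp (θ * (q ω - τ2)) ≤ Real.exp (-(θ * τ2)) *
      (1 + θ * q ω + (θ * (4 * κ * τ2)) ^ 2 / 3 * Real.exp (S ω)) := fun ω => by
    have hq0 : 0 ≤ q ω := Finset.sum_nonneg fun t _ => sq_nonneg _
    have h := exp_mul_le_one_add_add_sq_mul_exp hη (show 0 ≤ S ω by positivity)
    have e : θ * (4 * κ * τ2) * S ω = θ * q ω := by simp only [hS]; field_simp
    rw [e] at h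
    rw [show θ * (q ω - τ2) = -(θ * τ2) + θ * q ω by ring, Real.exp_add]
    gcongr
  have hi : Integrable (fun ω => Real.exp (-(θ * τ2)) *
      (1 + θ * q ω + (θ * (4 * κ * τ2)) ^ 2 / 3 * Real.exp (S ω))) μ :=
    (((integrable_const _).add (hqi.const_mul _)).add (hSi.const_mul _)).const_mul _
  calc ∫⁻ ω, ENNReal.ofReal (Real.exp (θ * (q ω - τ2))) ∂μ
      ≤ ∫⁻ ω, ENNReal.ofReal (Real.exp (-(θ * τ2)) *
          (1 + θ * q ω + (θ * (4 * κ * τ2)) ^ 2 / 3 * Real.exp (S ω))) ∂μ :=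
        lintegral_mono fun ω => ENNReal.ofReal_le_ofReal (hpt ω)
    _ = ENNReal.ofReal (∫ ω, Real.exp (-(θ * τ2)) *
          (1 + θ * q ω + (θ * (4 * κ * τ2)) ^ 2 / 3 * Real.exp (S ω)) ∂μ) :=
        (ofReal_integral_eq_lintegral_ofReal hi (Filter.Eventually.of_forall fun ω =>
          (Real.exp_pos _).le.trans (hpt ω))).symm
    _ ≤ _ := by
        apply ENNReal.ofReal_le_ofReal
        have h1 : ∫ ω, (1 + θ * q ω + (θ * (4 * κ * τ2)) ^ 2 / 3 * Real.exp (S ω)) ∂μ =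
            1 + θ * τ2 + (θ * (4 * κ * τ2)) ^ 2 / 3 * ∫ ω, Real.exp (S ω) ∂μ := by
          have hi1 : Integrable (fun ω => 1 + θ * q ω) μ :=
            (integrable_const _).add (hqi.const_mul _)
          rw [integral_add hi1 (hSi.const_mul _),
            integral_add (integrable_const _) (hqi.const_mul _), integral_const_mul,
            integral_const_mul, hqE]
          simp
        rw [integral_const_mul, h1]
        -- This turns the second-order coefficient (16/3)√2 into 8. The slack up to 9 is free: at θ
        -- = 2l the value 9 gives 36 l², the constant of the off-diagonal part.
        have h2 : √2 ≤ 3 / 2 := by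
          rw [Real.sqrt_le_left (by norm_num)]; norm_num
        have h3 : (θ * (4 * κ * τ2)) ^ 2 / 3 * ∫ ω, Real.exp (S ω) ∂μ ≤
            9 * θ ^ 2 * κ ^ 2 * τ2 ^ 2 := by
          calc _ ≤ (θ * (4 * κ * τ2)) ^ 2 / 3 * (3 / 2) := by gcongr; linarith
            _ = 8 * (θ ^ 2 * κ ^ 2 * τ2 ^ 2) := by ring
            _ ≤ 9 * (θ ^ 2 * κ ^ 2 * τ2 ^ 2) := by gcongr; norm_num
            _ = _ := by ring
        calc _ ≤ Real.exp (-(θ * τ2)) * (1 + θ * τ2 + 9 * θ ^ 2 * κ ^ 2 * τ2 ^ 2) := by gcongr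
          _ ≤ Real.exp (-(θ * τ2)) * Real.exp (θ * τ2 + 9 * θ ^ 2 * κ ^ 2 * τ2 ^ 2) := by
              gcongr
              have := Real.add_one_le_exp (θ * τ2 + 9 * θ ^ 2 * κ ^ 2 * τ2 ^ 2)
              linarith
          _ = _ := by rw [← Real.exp_add]; ring_nf

theorem lintegral_exp_centered_diagonal_le [IsProbabilityMeasure μ] {ι τ : Type*} [Fintype ι]
    [Fintype τ] {W : ι → Ω → EuclideanSpace ℝ (Fin d)} {κ : ℝ} (hmeas : ∀ i, Measurable (W i))
    (hindep : iIndepFun W μ) (hκ : 0 < κ) (hsub : ∀ i, IsSubGaussianVector (W i) κ μ)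
    (hiso : ∀ i, IsIsotropicVector (W i) μ) (b : τ → ι → EuclideanSpace ℝ (Fin d)) {θ : ℝ}
    (hθ : ∀ i, |θ| * κ * ∑ t, ‖b t i‖ ^ 2 ≤ 1 / 72) :
    ∫⁻ ω, ENNReal.ofReal (Real.exp (∑ i, θ * (∑ t, inner ℝ (b t i) (W i ω) ^ 2 -
      ∑ t, ‖b t i‖ ^ 2))) ∂μ ≤
      ENNReal.ofReal (Real.exp (∑ i, 9 * θ ^ 2 * κ ^ 2 * (∑ t, ‖b t i‖ ^ 2) ^ 2)) := by
  simp_rw [ofReal_exp_sum]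
  rw [lintegral_prod_eq_prod_lintegral_of_indepFun Finset.univ
    (fun i ω => ENNReal.ofReal (Real.exp (θ * (∑ t, inner ℝ (b t i) (W i ω) ^ 2 -
      ∑ t, ‖b t i‖ ^ 2))))
    (hindep.comp (fun i x => ENNReal.ofReal (Real.exp (θ * (∑ t, inner ℝ (b t i) x ^ 2 -
      ∑ t, ‖b t i‖ ^ 2)))) fun i => by fun_prop)
    (fun i => by have := hmeas i; fun_prop)]
  exact Finset.prod_le_prod' fun i _ =>
    lintegral_exp_centered_block_le (hmeas i) hκ (hsub i) (hiso i) (fun t => b t i) (hθ i)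

end CenteredBlocks

/-! ### Tools for decoupling and diagonalisation. -/

theorem inv_sqrt_one_sub_le_exp {x : ℝ} (h0 : 0 ≤ x) (h1 : x ≤ 1 / 9) :
    (√(1 - x))⁻¹ ≤ Real.exp (9 / 16 * x) := by
  have h2 : Real.exp (-(9 / 8 * x)) ≤ 1 - x := by
    rw [Real.exp_neg, inv_le_comm₀ (Real.exp_pos _) (by linarith)]
    refine le_trans ?_ (Real.add_one_le_exp _)
    rw [inv_le_iff_one_le_mul₀ (by linarith)]
    -- Here (1 + 9x/8)(1 - x) ≥ 1 amounts to x ≤ 1/9.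
    nlinarith
  rw [inv_le_comm₀ (Real.sqrt_pos.mpr (by linarith)) (Real.exp_pos _), ← Real.exp_neg]
  apply Real.le_sqrt_of_sq_le
  rw [← Real.exp_nat_mul]
  refine le_trans (le_of_eq ?_) h2
  congr 1; push_cast; ring

theorem ProbabilityTheory.IndepFun.lintegral_comp_le {Ω α β : Type*} [MeasurableSpace Ω]
    [MeasurableSpace α] [MeasurableSpace β] {μ : Measure Ω} [IsProbabilityMeasure μ]
    {U : Ω → α} {V : Ω → β} (hUV : IndepFun U V μ) (hU : Measurable U) (hV : Measurable V)
    {F : α → β → ENNReal} (hF : Measurable (Function.uncurry F)) {G : β → ENNReal}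
    (hG : Measurable G) (h : ∀ v, ∫⁻ ω, F (U ω) v ∂μ ≤ G v) :
    ∫⁻ ω, F (U ω) (V ω) ∂μ ≤ ∫⁻ ω, G (V ω) ∂μ := by
  have := Measure.isProbabilityMeasure_map (μ := μ) hU.aemeasurable
  have := Measure.isProbabilityMeasure_map (μ := μ) hV.aemeasurable
  calc ∫⁻ ω, F (U ω) (V ω) ∂μ
      = ∫⁻ p, Function.uncurry F p ∂(μ.map fun ω => (U ω, V ω)) := by
        rw [lintegral_map hF (hU.prodMk hV)]; rfl
    _ = ∫⁻ v, ∫⁻ u, F u v ∂(μ.map U) ∂(μ.map V) := by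
        rw [(indepFun_iff_map_prod_eq_prod_map_map hU.aemeasurable hV.aemeasurable).mp hUV,
          lintegral_prod_symm _ hF.aemeasurable]
        rfl
    _ ≤ ∫⁻ v, G v ∂(μ.map V) := by
        refine lintegral_mono fun v => ?_
        rw [lintegral_map (f := fun u => F u v)
          (hF.comp (measurable_id.prodMk measurable_const)) hU]
        exact h v
    _ = _ := lintegral_map hG hV

/-- These sets form the interval from {i} to the complement of {j}: the other card ι - 2 elements
are free. -/
theorem four_mul_card_filter_mem_notMem {ι : Type*} [Fintype ι] [DecidableEq ι] {i j : ι}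
    (hij : i ≠ j) :
    4 * (Finset.univ.filter fun I : Finset ι => i ∈ I ∧ j ∉ I).card = 2 ^ Fintype.card ι := by
  have h1 : (Finset.univ.filter fun I : Finset ι => i ∈ I ∧ j ∉ I) = Finset.Icc {i} {j}ᶜ := by
    ext I; simp [Finset.mem_Icc, Finset.subset_compl_singleton]
  have h2 : 2 ≤ Fintype.card ι := by
    have := Finset.card_le_univ ({i, j} : Finset ι)
    rwa [Finset.card_pair hij] at this
  rw [h1, Finset.card_Icc_finset (by simpa using hij.symm), Finset.card_compl,
    Finset.card_singleton, Finset.card_singleton, show (4 : ℕ) = 2 ^ 2 by norm_num, ← pow_add]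
  congr 1; omega

/-- A uniformly random I separates an ordered pair i ≠ j in this order with probability 1/4, whence
the factor 4. -/
theorem sum_offDiag_eq_average {ι : Type*} [Fintype ι] [DecidableEq ι] (c : ι → ι → ℝ) :
    ∑ i, ∑ j, (if i = j then 0 else c i j) =
      ∑ I : Finset ι, (2 ^ Fintype.card ι : ℝ)⁻¹ * (4 * ∑ i ∈ I, ∑ j ∈ Iᶜ, c i j) := by
  have h : ∀ I : Finset ι, ∑ i ∈ I, ∑ j ∈ Iᶜ, c i j =
      ∑ i, ∑ j, if i ∈ I ∧ j ∉ I then c i j else 0 := fun I => by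
    have h1 : ∀ i, ∑ j ∈ Iᶜ, c i j = ∑ j, if j ∉ I then c i j else 0 := fun i => by
      rw [← Finset.sum_filter]
      exact Finset.sum_congr (by ext; simp) fun _ _ => rfl
    have h2 : I = Finset.univ.filter fun i => i ∈ I := by ext; simp
    simp_rw [h1]
    rw [Finset.sum_congr h2 fun _ _ => rfl, Finset.sum_filter]
    refine Finset.sum_congr rfl fun i _ => ?_
    split_ifs with hi <;> simp [hi]
  have hcomm : ∑ I : Finset ι, ∑ i, ∑ j, (if i ∈ I ∧ j ∉ I then c i j else 0) =
      ∑ i, ∑ j, ∑ I : Finset ι, if i ∈ I ∧ j ∉ I then c i j else 0 := by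
    rw [Finset.sum_comm]
    exact Finset.sum_congr rfl fun i _ => Finset.sum_comm
  simp_rw [h]
  rw [← Finset.mul_sum, ← Finset.mul_sum, hcomm, Finset.mul_sum, Finset.mul_sum]
  refine Finset.sum_congr rfl fun i _ => ?_
  rw [Finset.mul_sum, Finset.mul_sum]
  refine Finset.sum_congr rfl fun j _ => ?_
  rw [← Finset.sum_filter, Finset.sum_const, nsmul_eq_mul]
  split_ifs with hij
  · simp [hij]
  · have := four_mul_card_filter_mem_notMem hij
    have h4 : (4 : ℝ) * (Finset.univ.filter fun I : Finset ι => i ∈ I ∧ j ∉ I).card =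
      2 ^ Fintype.card ι := by exact_mod_cast this
    rw [← mul_assoc 4, h4, inv_mul_cancel_left₀ (by positivity)]

theorem Matrix.IsHermitian.dotProduct_mulVec_sum_eigenvectorBasis {τ : Type*} [Fintype τ]
    [DecidableEq τ] {P : Matrix τ τ ℝ} (hP : P.IsHermitian) (g : τ → ℝ) :
    (fun t => ∑ k, g k * hP.eigenvectorBasis k t) ⬝ᵥ
      P.mulVec (fun t => ∑ k, g k * hP.eigenvectorBasis k t) =
        ∑ k, hP.eigenvalues k * g k ^ 2 := by
  have hx : (fun t => ∑ k, g k * hP.eigenvectorBasis k t) =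
      ∑ k, g k • (hP.eigenvectorBasis k).ofLp := by
    ext t; simp [Finset.sum_apply]
  have horth : ∀ k l, (hP.eigenvectorBasis k).ofLp ⬝ᵥ (hP.eigenvectorBasis l).ofLp =
      if k = l then 1 else 0 := fun k l => by
    have := orthonormal_iff_ite.mp hP.eigenvectorBasis.orthonormal l k
    rw [EuclideanSpace.inner_eq_star_dotProduct] at this
    simpa [eq_comm] using this
  rw [hx, Matrix.mulVec_sum, sum_dotProduct]
  simp_rw [Matrix.mulVec_smul, hP.mulVec_eigenvectorBasis, dotProduct_sum, smul_dotProduct,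
    dotProduct_smul, horth]
  simp only [smul_eq_mul, mul_ite, mul_one, mul_zero, Finset.sum_ite_eq, Finset.mem_univ, if_true]
  exact Finset.sum_congr rfl fun k _ => by ring

theorem Matrix.IsHermitian.sum_sq_eigenvectorBasis_mul {τ : Type*} [Fintype τ]
    [DecidableEq τ] {P : Matrix τ τ ℝ} (hP : P.IsHermitian) (x : τ → ℝ) :
    ∑ k, (∑ t, hP.eigenvectorBasis k t * x t) ^ 2 = ∑ t, x t ^ 2 := by
  have h := hP.eigenvectorBasis.sum_sq_norm_inner_right (WithLp.toLp 2 x)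
  rw [EuclideanSpace.real_norm_sq_eq] at h
  rw [← h]
  refine Finset.sum_congr rfl fun k _ => ?_
  rw [Real.norm_eq_abs, sq_abs, PiLp.inner_apply]
  congr 1
  exact Finset.sum_congr rfl fun t _ => by simp [mul_comm]

theorem Matrix.IsHermitian.dotProduct_mulVec_eq_sum_eigenvalues {τ : Type*} [Fintype τ]
    [DecidableEq τ] {P : Matrix τ τ ℝ} (hP : P.IsHermitian) (x : EuclideanSpace ℝ τ) :
    x.ofLp ⬝ᵥ P.mulVec x.ofLp =
      ∑ k, hP.eigenvalues k * inner ℝ (hP.eigenvectorBasis k) x ^ 2 := by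
  rw [← hP.dotProduct_mulVec_sum_eigenvectorBasis]
  have hx : x.ofLp =
      fun t => ∑ k, inner ℝ (hP.eigenvectorBasis k) x * hP.eigenvectorBasis k t := by
    conv_lhs => rw [← hP.eigenvectorBasis.sum_repr' x]
    ext t; simp
  rw [← hx]

/-! ### Off-diagonal part and the Hanson–Wright exponential moment. -/

section ExponentialMoments

variable {Ω : Type*} [MeasurableSpace Ω] {μ : Measure Ω} {d : ℕ}

theorem lintegral_exp_sum_mul_sum_inner_le {ι τ : Type*} [Fintype ι] [DecidableEq ι]
    [Fintype τ] {W : ι → Ω → EuclideanSpace ℝ (Fin d)} {κ : ℝ} (hmeas : ∀ i, Measurable (W i))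
    (hindep : iIndepFun W μ) (hsub : ∀ i, IsSubGaussianVector (W i) κ μ)
    (b : τ → ι → EuclideanSpace ℝ (Fin d)) (J : Finset ι) (h : τ → ℝ) :
    ∫⁻ ω, ENNReal.ofReal (Real.exp (∑ t, h t * ∑ i ∈ J, inner ℝ (b t i) (W i ω))) ∂μ ≤
      ENNReal.ofReal (Real.exp (κ / 2 * ∑ i ∈ J, ‖∑ t, h t • b t i‖ ^ 2)) := by
  have hJ : ∀ f : ι → ℝ, ∑ i ∈ J, f i = ∑ i, if i ∈ J then f i else 0 := fun f => by
    rw [Finset.sum_ite_mem, Finset.univ_inter]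
  refine le_trans (le_of_eq ?_) ((lintegral_exp_sum_inner_le hmeas hindep hsub
    (fun i => if i ∈ J then ∑ t, h t • b t i else 0)).trans (le_of_eq ?_))
  · refine lintegral_congr fun ω => congrArg _ (congrArg _ ?_)
    simp only [Finset.mul_sum]
    rw [Finset.sum_comm, hJ]
    refine Finset.sum_congr rfl fun i _ => ?_
    split_ifs
    · simp_rw [sum_inner, real_inner_smul_left]
    · simp
  · rw [hJ]
    congr 3
    refine Finset.sum_congr rfl fun i _ => ?_
    split_ifs <;> simp

/-- Exponential moments of the squared norm of `∑_{i ∈ J} b_i w_i`. -/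
theorem lintegral_exp_sum_sq_sum_inner_le [IsProbabilityMeasure μ] {ι τ : Type*} [Fintype ι]
    [Fintype τ] {W : ι → Ω → EuclideanSpace ℝ (Fin d)} {κ : ℝ} (hmeas : ∀ i, Measurable (W i))
    (hindep : iIndepFun W μ) (hκ : 0 < κ) (hsub : ∀ i, IsSubGaussianVector (W i) κ μ)
    (b : τ → ι → EuclideanSpace ℝ (Fin d)) {N : ℝ}
    (hN : ∀ g : τ → ℝ, ∑ i, ‖∑ t, g t • b t i‖ ^ 2 ≤ N * ∑ t, g t ^ 2)
    (hb : ∑ t, ∑ i, ‖b t i‖ ^ 2 ≤ 1) (J : Finset ι) {s : ℝ} (hs : 0 ≤ s)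
    (hsN : 2 * (s * κ) * N ≤ 1 / 9) :
    ∫⁻ ω, ENNReal.ofReal (Real.exp (s * ∑ t, (∑ i ∈ J, inner ℝ (b t i) (W i ω)) ^ 2)) ∂μ ≤
      ENNReal.ofReal (Real.exp (9 / 16 * (2 * (s * κ)))) := by
  classical
  -- In the eigenbasis of this Gram matrix the covariance proxy becomes diagonal, as the Gaussian
  -- comparison requires. Its eigenvalues are at most N and its trace at most 1, so the final bound
  -- does not depend on the size of τ.
  set P : Matrix τ τ ℝ := Matrix.of fun t t' => ∑ i ∈ J, inner ℝ (b t i) (b t' i) with hP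
  have hPH : P.IsHermitian := by
    ext t t'
    simp [hP, real_inner_comm]
  have hquad : ∀ h : τ → ℝ, h ⬝ᵥ P.mulVec h = ∑ i ∈ J, ‖∑ t, h t • b t i‖ ^ 2 := fun h => by
    simp_rw [← real_inner_self_eq_norm_sq, sum_inner, inner_sum, real_inner_smul_left,
      real_inner_smul_right]
    rw [Finset.sum_comm]
    simp only [dotProduct, Matrix.mulVec, hP, Matrix.of_apply]
    refine Finset.sum_congr rfl fun t _ => ?_
    rw [Finset.sum_comm, Finset.mul_sum]
    refine Finset.sum_congr rfl fun t' _ => ?_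
    rw [Finset.sum_mul, Finset.mul_sum]
    refine Finset.sum_congr rfl fun i _ => ?_
    ring
  set e : τ → τ → ℝ := fun k t => hPH.eigenvectorBasis k t with he
  set m := hPH.eigenvalues
  have hnorm : ∀ x : τ → ℝ, ∑ k, (∑ t, e k t * x t) ^ 2 = ∑ t, x t ^ 2 :=
    hPH.sum_sq_eigenvectorBasis_mul
  have hone : ∀ k, ∑ t, e k t ^ 2 = 1 := fun k => by
    rw [← EuclideanSpace.real_norm_sq_eq, hPH.eigenvectorBasis.orthonormal.1 k, one_pow]
  have htr : ∑ k, m k = P.trace := by simpa using hPH.trace_eq_sum_eigenvalues.symm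
  have hdiag : ∀ g : τ → ℝ, (fun t => ∑ k, g k * e k t) ⬝ᵥ
      P.mulVec (fun t => ∑ k, g k * e k t) = ∑ k, m k * g k ^ 2 :=
    hPH.dotProduct_mulVec_sum_eigenvectorBasis
  have hmk : ∀ k, m k = ∑ i ∈ J, ‖∑ t, e k t • b t i‖ ^ 2 := fun k => by
    have h := hdiag (Pi.single k 1)
    rw [hquad] at h
    simpa [Pi.single_apply] using h.symm
  have hm0 : ∀ k, 0 ≤ m k := fun k => by rw [hmk]; positivity
  have hmN : ∀ k, m k ≤ N := fun k => by
    have h := hN (e k)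
    rw [hone, mul_one] at h
    rw [hmk]
    exact (Finset.sum_le_univ_sum_of_nonneg fun i => by positivity).trans h
  have hm1 : ∑ k, m k ≤ 1 := by
    rw [htr]
    refine le_trans ?_ hb
    refine Finset.sum_le_sum fun t _ => ?_
    simp only [Matrix.diag_apply, hP, Matrix.of_apply, real_inner_self_eq_norm_sq]
    exact Finset.sum_le_univ_sum_of_nonneg fun i => by positivity
  have hx : ∀ k, 2 * (s * (κ * m k)) ≤ 1 / 9 := fun k => by
    calc 2 * (s * (κ * m k)) = 2 * (s * κ) * m k := by ring
      _ ≤ 2 * (s * κ) * N := by gcongr; exact hmN k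
      _ ≤ 1 / 9 := hsN
  have key := lintegral_exp_sum_sq_le (μ := μ) (s := s) (γ := fun k => κ * m k)
    (Y := fun k ω => ∑ t, e k t * ∑ i ∈ J, inner ℝ (b t i) (W i ω)) (fun k => by fun_prop) hs
    (fun k => (hx k).trans_lt (by norm_num)) (fun g => by
      refine le_trans (le_of_eq ?_) ((lintegral_exp_sum_mul_sum_inner_le hmeas hindep hsub b J
        (fun t => ∑ k, g k * e k t)).trans (le_of_eq ?_))
      · refine lintegral_congr fun ω => congrArg _ (congrArg _ ?_)
        simp_rw [Finset.mul_sum _ _ (g _), Finset.sum_mul]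
        rw [Finset.sum_comm]
        simp_rw [mul_assoc]
      · rw [← hquad, hdiag, Finset.mul_sum]
        congr 2
        exact Finset.sum_congr rfl fun k _ => by ring)
  simp only [hnorm] at key
  refine key.trans (ENNReal.ofReal_le_ofReal ?_)
  calc ∏ k, (√(1 - 2 * (s * (κ * m k))))⁻¹
      ≤ ∏ k, Real.exp (9 / 16 * (2 * (s * (κ * m k)))) :=
        Finset.prod_le_prod (fun k _ => by positivity) fun k _ =>
          inv_sqrt_one_sub_le_exp (by have := hm0 k; positivity) (hx k)
    _ = Real.exp (9 / 16 * (2 * (s * κ)) * ∑ k, m k) := by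
        rw [← Real.exp_sum, Finset.mul_sum]
        congr 1
        exact Finset.sum_congr rfl fun k _ => by ring
    _ ≤ _ := by
        apply Real.exp_le_exp.mpr
        exact mul_le_of_le_one_right (by positivity) hm1

/-- With the noise in the complement frozen, the exponent is linear in the noise of I. Integrating
it out leaves a squared norm with s = κρ²N/2, and the smallness condition 2sκN ≤ 1/9 becomes the
hypothesis on ρ. -/
theorem lintegral_exp_decoupled_le [IsProbabilityMeasure μ] {ι τ : Type*} [Fintype ι]
    [DecidableEq ι] [Fintype τ] {W : ι → Ω → EuclideanSpace ℝ (Fin d)} {κ : ℝ}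
    (hmeas : ∀ i, Measurable (W i)) (hindep : iIndepFun W μ) (hκ : 0 < κ)
    (hsub : ∀ i, IsSubGaussianVector (W i) κ μ) (b : τ → ι → EuclideanSpace ℝ (Fin d)) {N : ℝ}
    (hN0 : 0 ≤ N) (hN : ∀ g : τ → ℝ, ∑ i, ‖∑ t, g t • b t i‖ ^ 2 ≤ N * ∑ t, g t ^ 2)
    (hb : ∑ t, ∑ i, ‖b t i‖ ^ 2 ≤ 1) (I : Finset ι) {ρ : ℝ} (hρ : (ρ * κ * N) ^ 2 ≤ 1 / 9) :
    ∫⁻ ω, ENNReal.ofReal (Real.exp (ρ * ∑ t, (∑ i ∈ I, inner ℝ (b t i) (W i ω)) *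
      ∑ i ∈ Iᶜ, inner ℝ (b t i) (W i ω))) ∂μ ≤
      ENNReal.ofReal (Real.exp (9 / 16 * (ρ ^ 2 * κ ^ 2 * N))) := by
  have hind : IndepFun (fun ω t => ∑ i ∈ I, inner ℝ (b t i) (W i ω))
      (fun ω t => ∑ i ∈ Iᶜ, inner ℝ (b t i) (W i ω)) μ := by
    have h := (hindep.indepFun_finset I Iᶜ disjoint_compl_right hmeas).comp
      (φ := fun (u : I → EuclideanSpace ℝ (Fin d)) t => ∑ i : I, inner ℝ (b t i) (u i))
      (ψ := fun (u : (Iᶜ : Finset ι) → EuclideanSpace ℝ (Fin d)) t =>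
        ∑ i : (Iᶜ : Finset ι), inner ℝ (b t i) (u i)) (by fun_prop) (by fun_prop)
    convert h using 1
    · ext ω t
      exact (Finset.sum_coe_sort I fun i => inner ℝ (b t i) (W i ω)).symm
    · ext ω t
      exact (Finset.sum_coe_sort Iᶜ fun i => inner ℝ (b t i) (W i ω)).symm
  refine (hind.lintegral_comp_le (F := fun a c => ENNReal.ofReal (Real.exp (ρ * ∑ t, a t * c t)))
    (G := fun c => ENNReal.ofReal (Real.exp (κ / 2 * ρ ^ 2 * N * ∑ t, c t ^ 2)))
    (by fun_prop) (by fun_prop) (by simp only [Function.uncurry_def]; fun_prop) (by fun_prop)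
    fun c => ?_).trans ?_
  · refine le_trans (le_of_eq ?_) ((lintegral_exp_sum_mul_sum_inner_le hmeas hindep hsub b I
      (fun t => ρ * c t)).trans (ENNReal.ofReal_le_ofReal (Real.exp_le_exp.mpr ?_)))
    · refine lintegral_congr fun ω => congrArg _ (congrArg _ ?_)
      rw [Finset.mul_sum]
      exact Finset.sum_congr rfl fun t _ => by ring
    · calc κ / 2 * ∑ i ∈ I, ‖∑ t, (ρ * c t) • b t i‖ ^ 2
          ≤ κ / 2 * ∑ i, ‖∑ t, (ρ * c t) • b t i‖ ^ 2 := by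
            gcongr
            exact Finset.subset_univ I
        _ ≤ κ / 2 * (N * ∑ t, (ρ * c t) ^ 2) := by gcongr; exact hN _
        _ = _ := by simp_rw [mul_pow, ← Finset.mul_sum]; ring
  · refine (lintegral_exp_sum_sq_sum_inner_le hmeas hindep hκ hsub b hN hb Iᶜ
      (by positivity) ?_).trans (le_of_eq ?_)
    · refine le_trans (le_of_eq ?_) hρ
      ring
    · congr 2; ring

theorem sq_sum_eq_diag_add_offDiag {ι : Type*} [Fintype ι] [DecidableEq ι] (x : ι → ℝ) :
    (∑ i, x i) ^ 2 = ∑ i, x i ^ 2 + ∑ i, ∑ j, if i = j then 0 else x i * x j := by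
  rw [sq, Finset.sum_mul_sum, ← Finset.sum_add_distrib]
  refine Finset.sum_congr rfl fun i _ => ?_
  rw [← Finset.add_sum_erase _ _ (Finset.mem_univ i), ← sq]
  congr 1
  rw [← Finset.add_sum_erase _ (fun j => if i = j then 0 else x i * x j) (Finset.mem_univ i)]
  simp only [if_true, zero_add]
  exact Finset.sum_congr rfl fun j hj => by rw [if_neg (Finset.ne_of_mem_erase hj).symm]

/-- Exponential moment bound for the centered squared norm of a linear image of a vector with
independent isotropic sub-Gaussian blocks. -/
theorem lintegral_exp_centered_sum_sq_le [IsProbabilityMeasure μ] {ι τ : Type*} [Fintype ι]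
    [Fintype τ] {W : ι → Ω → EuclideanSpace ℝ (Fin d)} {κ : ℝ} (hmeas : ∀ i, Measurable (W i))
    (hindep : iIndepFun W μ) (hκ : 1 ≤ κ) (hsub : ∀ i, IsSubGaussianVector (W i) κ μ)
    (hiso : ∀ i, IsIsotropicVector (W i) μ) (b : τ → ι → EuclideanSpace ℝ (Fin d)) {N : ℝ}
    (hN : ∀ g : τ → ℝ, ∑ i, ‖∑ t, g t • b t i‖ ^ 2 ≤ N * ∑ t, g t ^ 2)
    (hcol : ∀ i, ∑ t, ‖b t i‖ ^ 2 ≤ N) (hb : ∑ t, ∑ i, ‖b t i‖ ^ 2 = 1) {l : ℝ}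
    (hl : |l| * (κ ^ 2 * N) ≤ 1 / 144) :
    ∫⁻ ω, ENNReal.ofReal (Real.exp (l * (∑ t, (∑ i, inner ℝ (b t i) (W i ω)) ^ 2 - 1))) ∂μ ≤
      ENNReal.ofReal (Real.exp (36 * l ^ 2 * (κ ^ 2 * N))) := by
  classical
  have hb' : ∑ i, ∑ t, ‖b t i‖ ^ 2 = 1 := by rw [Finset.sum_comm]; exact hb
  have hN0 : 0 ≤ N := by
    rcases isEmpty_or_nonempty ι with h | ⟨⟨i⟩⟩
    · simp at hb
    · exact le_trans (by positivity) (hcol i)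
  have hκ0 : 0 < κ := by linarith
  -- The step where κ ≥ 1 enters: a condition on κ²N controls κN.
  have hlκ : |l| * κ * N ≤ 1 / 144 := by
    refine le_trans ?_ hl
    rw [mul_assoc]
    gcongr
    nlinarith
  set D : Ω → ℝ := fun ω => ∑ i, 2 * l * (∑ t, inner ℝ (b t i) (W i ω) ^ 2 - ∑ t, ‖b t i‖ ^ 2)
    with hD
  -- The 8 is the 4 of the subset average times the 2 compensating the convex weight 1/2; `D`
  -- carries that same 2.
  set O : Finset ι → Ω → ℝ := fun I ω => 8 * l * ∑ t, (∑ i ∈ I, inner ℝ (b t i) (W i ω)) *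
      ∑ i ∈ Iᶜ, inner ℝ (b t i) (W i ω) with hO
  set p : ℝ := (2 ^ Fintype.card ι : ℝ)⁻¹ with hp
  have hp0 : 0 < p := by positivity
  have hpsum : ∑ _I : Finset ι, p = 1 := by
    rw [Finset.sum_const, Finset.card_univ, Fintype.card_finset, nsmul_eq_mul, hp]
    push_cast
    exact mul_inv_cancel₀ (by positivity)
  have hsplit : ∀ ω, l * (∑ t, (∑ i, inner ℝ (b t i) (W i ω)) ^ 2 - 1) =
      1 / 2 * D ω + 1 / 2 * ∑ I, p * O I ω := fun ω => by
    have h1 : ∑ t, (∑ i, inner ℝ (b t i) (W i ω)) ^ 2 =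
        ∑ i, ∑ t, inner ℝ (b t i) (W i ω) ^ 2 + ∑ i, ∑ j, (if i = j then 0 else
          ∑ t, inner ℝ (b t i) (W i ω) * inner ℝ (b t j) (W j ω)) := by
      simp_rw [sq_sum_eq_diag_add_offDiag, Finset.sum_add_distrib]
      congr 1
      · exact Finset.sum_comm
      · rw [Finset.sum_comm]
        refine Finset.sum_congr rfl fun i _ => ?_
        rw [Finset.sum_comm]
        refine Finset.sum_congr rfl fun j _ => ?_
        split_ifs <;> simp
    have h2 : ∀ I : Finset ι, ∑ i ∈ I, ∑ j ∈ Iᶜ, ∑ t, inner ℝ (b t i) (W i ω) *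
        inner ℝ (b t j) (W j ω) = ∑ t, (∑ i ∈ I, inner ℝ (b t i) (W i ω)) *
          ∑ i ∈ Iᶜ, inner ℝ (b t i) (W i ω) := fun I => by
      simp_rw [Finset.sum_mul_sum]
      rw [Finset.sum_comm (s := Finset.univ)]
      exact Finset.sum_congr rfl fun i _ => Finset.sum_comm
    rw [h1, sum_offDiag_eq_average]
    simp_rw [h2]
    simp only [hD, hO, ← Finset.mul_sum, Finset.sum_sub_distrib, hb', ← hp]
    ring
  have hpt : ∀ ω, Real.exp (l * (∑ t, (∑ i, inner ℝ (b t i) (W i ω)) ^ 2 - 1)) ≤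
      1 / 2 * Real.exp (D ω) + 1 / 2 * ∑ I, p * Real.exp (O I ω) := fun ω => by
    rw [hsplit]
    refine (convexOn_exp.2 (Set.mem_univ _) (Set.mem_univ _) (by norm_num) (by norm_num)
      (by norm_num)).trans ?_
    simp only [smul_eq_mul]
    gcongr
    exact convexOn_exp.map_sum_le (fun _ _ => hp0.le) hpsum (fun _ _ => Set.mem_univ _)
  have hDm : Measurable D := by fun_prop
  have hOm : ∀ I, Measurable (O I) := fun I => by fun_prop
  set R := ENNReal.ofReal (Real.exp (36 * l ^ 2 * (κ ^ 2 * N))) with hR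
  have hDle : ∫⁻ ω, ENNReal.ofReal (Real.exp (D ω)) ∂μ ≤ R := by
    refine (lintegral_exp_centered_diagonal_le hmeas hindep hκ0 hsub hiso b fun i => ?_).trans
      (ENNReal.ofReal_le_ofReal (Real.exp_le_exp.mpr ?_))
    · rw [abs_mul, abs_two]
      calc 2 * |l| * κ * ∑ t, ‖b t i‖ ^ 2 ≤ 2 * |l| * κ * N := by gcongr; exact hcol i
        _ ≤ 1 / 72 := by linarith
    · calc ∑ i, 9 * (2 * l) ^ 2 * κ ^ 2 * (∑ t, ‖b t i‖ ^ 2) ^ 2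
          ≤ ∑ i, 9 * (2 * l) ^ 2 * κ ^ 2 * (N * ∑ t, ‖b t i‖ ^ 2) := by
            gcongr with i
            rw [sq]
            gcongr
            exact hcol i
        _ = _ := by rw [← Finset.mul_sum, ← Finset.mul_sum, hb']; ring
  have hOle : ∀ I, ∫⁻ ω, ENNReal.ofReal (Real.exp (O I ω)) ∂μ ≤ R := fun I => by
    refine (lintegral_exp_decoupled_le hmeas hindep hκ0 hsub b hN0 hN hb.le I ?_).trans
      (le_of_eq ?_)
    · have h : |8 * l * κ * N| ≤ 1 / 3 := by
        rw [abs_mul, abs_mul, abs_mul, abs_of_nonneg hN0, abs_of_pos hκ0]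
        norm_num
        linarith
      rw [← sq_abs]
      calc |8 * l * κ * N| ^ 2 ≤ (1 / 3) ^ 2 := by gcongr
        _ = 1 / 9 := by norm_num
    · rw [hR]; congr 2; ring
  calc ∫⁻ ω, ENNReal.ofReal (Real.exp (l * (∑ t, (∑ i, inner ℝ (b t i) (W i ω)) ^ 2 - 1))) ∂μ
      ≤ ∫⁻ ω, (ENNReal.ofReal (1 / 2) * ENNReal.ofReal (Real.exp (D ω)) +
          ENNReal.ofReal (1 / 2) * ∑ I, ENNReal.ofReal p * ENNReal.ofReal (Real.exp (O I ω))) ∂μ := by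
        refine lintegral_mono fun ω => (ENNReal.ofReal_le_ofReal (hpt ω)).trans (le_of_eq ?_)
        rw [ENNReal.ofReal_add (by positivity) (by positivity), ENNReal.ofReal_mul (by norm_num),
          ENNReal.ofReal_mul (by norm_num), ENNReal.ofReal_sum_of_nonneg fun I _ => by positivity]
        simp_rw [ENNReal.ofReal_mul hp0.le]
    _ = ENNReal.ofReal (1 / 2) * ∫⁻ ω, ENNReal.ofReal (Real.exp (D ω)) ∂μ +
          ENNReal.ofReal (1 / 2) * ∑ I, ENNReal.ofReal p *
            ∫⁻ ω, ENNReal.ofReal (Real.exp (O I ω)) ∂μ := by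
        rw [lintegral_add_left (by fun_prop), lintegral_const_mul _ (by fun_prop),
          lintegral_const_mul _ (by fun_prop), lintegral_finsetSum _ fun I _ => by
            have := hOm I; fun_prop]
        congr 2
        exact Finset.sum_congr rfl fun I _ => lintegral_const_mul _ (by have := hOm I; fun_prop)
    _ ≤ ENNReal.ofReal (1 / 2) * R + ENNReal.ofReal (1 / 2) * ∑ I : Finset ι, ENNReal.ofReal p * R := by
        gcongr with I
        exact hOle I
    _ = R := by
        rw [← Finset.sum_mul, ← ENNReal.ofReal_sum_of_nonneg fun _ _ => hp0.le, hpsum,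
          ENNReal.ofReal_one, one_mul, ← add_mul, ← ENNReal.ofReal_add (by norm_num) (by norm_num)]
        norm_num

end ExponentialMoments

/-! ### Chernoff tail bound, and the bound κ ≥ 1. -/

theorem meas_ge_le_of_lintegral_exp_le {Ω : Type*} [MeasurableSpace Ω] {μ : Measure Ω} {Z : Ω → ℝ}
    (hZ : Measurable Z) {r : ℝ} (h : ∫⁻ ω, ENNReal.ofReal (Real.exp (Z ω)) ∂μ ≤
      ENNReal.ofReal (Real.exp r)) (a : ℝ) :
    μ {ω | a ≤ Z ω} ≤ ENNReal.ofReal (Real.exp (r - a)) := by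
  have h1 := meas_ge_le_lintegral_div (μ := μ) (f := fun ω => ENNReal.ofReal (Real.exp (Z ω)))
    (by fun_prop) (ε := ENNReal.ofReal (Real.exp a)) (by simp [Real.exp_pos]) (by simp)
  have h2 : {ω | a ≤ Z ω} =
      {ω | ENNReal.ofReal (Real.exp a) ≤ ENNReal.ofReal (Real.exp (Z ω))} := by
    ext ω
    simp [ENNReal.ofReal_le_ofReal_iff (Real.exp_pos _).le]
  rw [h2, Real.exp_sub, ENNReal.ofReal_div_of_pos (Real.exp_pos _)]
  exact h1.trans (ENNReal.div_le_div_right h _)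

theorem meas_abs_ge_le_of_lintegral_exp_le {Ω : Type*} [MeasurableSpace Ω] {μ : Measure Ω}
    {Z : Ω → ℝ} (hZ : Measurable Z) {N : ℝ} (hN : 0 < N)
    (h : ∀ l : ℝ, |l| * N ≤ 1 / 144 → ∫⁻ ω, ENNReal.ofReal (Real.exp (l * Z ω)) ∂μ ≤
      ENNReal.ofReal (Real.exp (36 * l ^ 2 * N))) {ε : ℝ} (hε : 0 < ε) :
    μ {ω | max ε (ε ^ 2) / 2 ≤ |Z ω|} ≤ ENNReal.ofReal (2 * Real.exp (-(ε ^ 2 / (576 * N)))) := by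
  -- The truncation at 1 keeps l admissible for large ε. The exponent is then at most -ε²/(576N),
  -- because min(ε,1)² + ε² ≤ 2 min(ε,1) max(ε,ε²).
  set l := min ε 1 / (144 * N) with hl
  have hmin : 0 < min ε 1 := lt_min hε one_pos
  have hl0 : 0 < l := by positivity
  have hlN : |l| * N ≤ 1 / 144 := by
    have h1 : l * N = min ε 1 / 144 := by rw [hl]; field_simp
    rw [abs_of_pos hl0, h1]
    gcongr
    exact min_le_right _ _
  have hr : 36 * l ^ 2 * N - l * (max ε (ε ^ 2) / 2) ≤ -(ε ^ 2 / (576 * N)) := by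
    have hkey : (min ε 1) ^ 2 + ε ^ 2 ≤ 2 * (min ε 1 * max ε (ε ^ 2)) := by
      rcases le_total ε 1 with h1 | h1
      · rw [min_eq_left h1, max_eq_left (by nlinarith)]; nlinarith
      · rw [min_eq_right h1, max_eq_right (by nlinarith)]; nlinarith
    have e : 36 * l ^ 2 * N - l * (max ε (ε ^ 2) / 2) + ε ^ 2 / (576 * N) =
        ((min ε 1) ^ 2 + ε ^ 2 - 2 * (min ε 1 * max ε (ε ^ 2))) / (576 * N) := by
      rw [hl]; field_simp; ring
    have : ((min ε 1) ^ 2 + ε ^ 2 - 2 * (min ε 1 * max ε (ε ^ 2))) / (576 * N) ≤ 0 :=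
      div_nonpos_of_nonpos_of_nonneg (by linarith) (by positivity)
    linarith
  have hside : ∀ σ : ℝ, |σ| = 1 → μ {ω | l * (max ε (ε ^ 2) / 2) ≤ σ * l * Z ω} ≤
      ENNReal.ofReal (Real.exp (-(ε ^ 2 / (576 * N)))) := fun σ hσ => by
    refine (meas_ge_le_of_lintegral_exp_le (hZ.const_mul _) (h (σ * l) ?_) _).trans
      (ENNReal.ofReal_le_ofReal (Real.exp_le_exp.mpr (le_trans (le_of_eq ?_) hr)))
    · rwa [abs_mul, hσ, one_mul]
    · have : σ ^ 2 = 1 := by rw [← sq_abs, hσ, one_pow]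
      rw [mul_pow, this, one_mul]
  calc μ {ω | max ε (ε ^ 2) / 2 ≤ |Z ω|}
      ≤ μ ({ω | l * (max ε (ε ^ 2) / 2) ≤ 1 * l * Z ω} ∪
          {ω | l * (max ε (ε ^ 2) / 2) ≤ -1 * l * Z ω}) := by
        refine measure_mono fun ω hω => ?_
        rcases le_abs.mp (show max ε (ε ^ 2) / 2 ≤ |Z ω| from hω) with h1 | h1
        · left
          simp only [Set.mem_ofPred_eq, one_mul]
          gcongr
        · right
          simp only [Set.mem_ofPred_eq]
          calc l * (max ε (ε ^ 2) / 2) ≤ l * -Z ω := by gcongr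
            _ = -1 * l * Z ω := by ring
    _ ≤ _ := by
        refine (measure_union_le _ _).trans ((add_le_add (hside 1 (by simp))
          (hside (-1) (by simp))).trans (le_of_eq ?_))
        rw [← ENNReal.ofReal_add (by positivity) (by positivity), two_mul]

theorem Real.one_add_sq_div_two_le_cosh (x : ℝ) : 1 + x ^ 2 / 2 ≤ Real.cosh x := by
  rw [← Real.cosh_abs, ← sq_abs]
  have h0 : 0 ≤ |x| / 2 := by positivity
  have h1 := Real.self_le_sinh_iff.mpr h0
  have h2 : Real.cosh |x| = 1 + 2 * Real.sinh (|x| / 2) ^ 2 := by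
    have := Real.cosh_two_mul (|x| / 2)
    rw [mul_div_cancel₀ _ two_ne_zero, Real.cosh_sq] at this
    linarith
  have h3 := pow_le_pow_left₀ h0 h1 2
  rw [h2]
  linarith

/-- Averaging the bounds at t v and -t v gives 1 + t²/2 ≤ E cosh(t⟨v,W⟩) ≤ exp(κt²/2), so small t
force κ ≥ 1. -/
theorem one_le_of_isSubGaussianVector_of_isIsotropicVector {Ω : Type*} [MeasurableSpace Ω]
    {μ : Measure Ω} [IsProbabilityMeasure μ] {d : ℕ} [NeZero d]
    {w : Ω → EuclideanSpace ℝ (Fin d)} {κ : ℝ}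
    (hw : IsSubGaussianVector w κ μ) (hiso : IsIsotropicVector w μ) : 1 ≤ κ := by
  set v : EuclideanSpace ℝ (Fin d) := EuclideanSpace.single 0 1
  have hv : ‖v‖ = 1 := by simp [v]
  have key : ∀ t : ℝ, 1 + t ^ 2 / 2 ≤ Real.exp (κ * t ^ 2 / 2) := fun t => by
    obtain ⟨hi, hE⟩ := hiso.integral_inner_sq v
    obtain ⟨hi1, hE1⟩ := hw (t • v)
    obtain ⟨hi2, hE2⟩ := hw (-(t • v))
    rw [norm_neg] at hE2
    rw [norm_smul, mul_pow, Real.norm_eq_abs, sq_abs, hv, one_pow, mul_one] at hE1 hE2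
    have hle : ∫ ω, (1 + t ^ 2 / 2 * inner ℝ v (w ω) ^ 2) ∂μ ≤
        ∫ ω, (1 / 2 * Real.exp (inner ℝ (t • v) (w ω)) +
          1 / 2 * Real.exp (inner ℝ (-(t • v)) (w ω))) ∂μ := by
      refine integral_mono ((integrable_const _).add (hi.const_mul _))
        ((hi1.const_mul _).add (hi2.const_mul _)) fun ω => ?_
      simp only [inner_neg_left, real_inner_smul_left]
      have h := Real.one_add_sq_div_two_le_cosh (t * inner ℝ v (w ω))
      rw [Real.cosh_eq] at h
      nlinarith
    rw [integral_add (integrable_const _) (hi.const_mul _), integral_add (hi1.const_mul _)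
      (hi2.const_mul _), integral_const_mul, integral_const_mul, integral_const_mul, hE, hv] at hle
    simp only [integral_const, probReal_univ, smul_eq_mul, mul_one, one_pow] at hle
    linarith
  by_contra! hκ
  -- The explicit choice t² = 1 - κ replaces the limit t → 0.
  have h := key (√(1 - κ))
  rw [Real.sq_sqrt (by linarith)] at h
  have hx : κ * (1 - κ) / 2 < 1 := by nlinarith [sq_nonneg (κ - 1)]
  have h2 : 1 - κ * (1 - κ) / 2 ≤ Real.exp (-(κ * (1 - κ) / 2)) := by
    have := Real.add_one_le_exp (-(κ * (1 - κ) / 2)); linarith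
  have h3 : (1 + (1 - κ) / 2) * (1 - κ * (1 - κ) / 2) ≤ 1 := by
    calc _ ≤ Real.exp (κ * (1 - κ) / 2) * Real.exp (-(κ * (1 - κ) / 2)) := by
          apply mul_le_mul h h2 (by linarith) (Real.exp_pos _).le
      _ = 1 := by rw [← Real.exp_add]; simp
  nlinarith [mul_pos (sub_pos.mpr hκ) (sub_pos.mpr hκ)]

/-! ### Quarter-nets of the unit sphere. -/

section Net

open Metric Module

variable {E : Type*} [NormedAddCommGroup E] [NormedSpace ℝ E] [FiniteDimensional ℝ E]

/-- Volume packing: disjoint balls of radius 1/8 lie in the ball of radius 9/8. -/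
theorem card_le_nine_pow_of_separated (s : Finset E) (hs : ∀ c ∈ s, ‖c‖ = 1)
    (h : ∀ c ∈ s, ∀ d ∈ s, c ≠ d → 1 / 4 ≤ ‖c - d‖) : s.card ≤ 9 ^ finrank ℝ E := by
  borelize E
  let μ : Measure E := Measure.addHaar
  have hdisj : Set.Pairwise (s : Set E) (Function.onFun Disjoint fun c => ball (c : E) (1 / 8)) := by
    rintro c hc d hd hcd
    apply ball_disjoint_ball
    rw [dist_eq_norm]
    exact le_trans (by norm_num) (h c hc d hd hcd)
  have hsub : (⋃ c ∈ s, ball (c : E) (1 / 8)) ⊆ ball (0 : E) (9 / 8) := by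
    refine Set.iUnion₂_subset fun x hx => ball_subset_ball' ?_
    rw [dist_zero_right, hs x hx]; norm_num
  have hvol : (s.card : ENNReal) * ENNReal.ofReal ((1 / 8) ^ finrank ℝ E) * μ (ball 0 1) ≤
      ENNReal.ofReal ((9 / 8) ^ finrank ℝ E) * μ (ball 0 1) :=
    calc _ = μ (⋃ c ∈ s, ball (c : E) (1 / 8)) := by
          rw [measure_biUnion_finset hdisj fun c _ => measurableSet_ball]
          simp only [μ.addHaar_ball_of_pos _ (show (0 : ℝ) < 1 / 8 by norm_num)]
          simp only [Finset.sum_const, nsmul_eq_mul, mul_assoc]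
      _ ≤ μ (ball (0 : E) (9 / 8)) := measure_mono hsub
      _ = _ := by rw [μ.addHaar_ball_of_pos _ (show (0 : ℝ) < 9 / 8 by norm_num)]
  have hcard := (ENNReal.mul_le_mul_iff_left (measure_ball_pos μ _ zero_lt_one).ne'
    measure_ball_lt_top.ne).1 hvol
  have hreal : (s.card : ℝ) ≤ (9 : ℝ) ^ finrank ℝ E := by
    have := ENNReal.toReal_le_of_le_ofReal (by positivity) hcard
    simpa [div_eq_mul_inv, mul_pow] using this
  exact_mod_cast hreal

theorem exists_quarter_net_sphere : ∃ s : Finset E, (∀ c ∈ s, ‖c‖ = 1) ∧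
    s.card ≤ 9 ^ finrank ℝ E ∧ ∀ u : E, ‖u‖ = 1 → ∃ c ∈ s, ‖u - c‖ ≤ 1 / 4 := by
  classical
  let Q : ℕ → Prop := fun n => ∃ s : Finset E, s.card = n ∧ (∀ c ∈ s, ‖c‖ = 1) ∧
    ∀ c ∈ s, ∀ d ∈ s, c ≠ d → 1 / 4 ≤ ‖c - d‖
  -- A separated set of maximal cardinality is a net, since a point far from all of it could be
  -- added.
  obtain ⟨s, hcard, hs, hsep⟩ : Q (Nat.findGreatest Q (9 ^ finrank ℝ E)) :=
    Nat.findGreatest_spec (m := 0) (Nat.zero_le _) ⟨∅, by simp, by simp, by simp⟩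
  refine ⟨s, hs, card_le_nine_pow_of_separated s hs hsep, fun u hu => ?_⟩
  by_contra! hfar
  have hnot : u ∉ s := fun hus => by
    have := hfar u hus
    norm_num at this
  have hs' : ∀ c ∈ insert u s, ‖c‖ = 1 := by
    simp only [Finset.mem_insert]
    rintro c (rfl | hc)
    exacts [hu, hs c hc]
  have hsep' : ∀ c ∈ insert u s, ∀ d ∈ insert u s, c ≠ d → 1 / 4 ≤ ‖c - d‖ := by
    simp only [Finset.mem_insert]
    rintro c (rfl | hc) d (rfl | hd) hne
    · exact absurd rfl hne
    · exact (hfar d hd).le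
    · rw [norm_sub_rev]; exact (hfar c hc).le
    · exact hsep c hc d hd hne
  have hQ : Q (s.card + 1) := ⟨insert u s, Finset.card_insert_of_notMem hnot, hs', hsep'⟩
  have hle := Nat.le_findGreatest (P := Q)
    ((Finset.card_insert_of_notMem hnot).symm.le.trans
      (card_le_nine_pow_of_separated _ hs' hsep')) hQ
  rw [← hcard] at hle
  exact absurd hle (Nat.not_succ_le_self _)

end Net

/-! ### Quadratic forms: from the net to the sphere, and to eigenvalues. -/

/-- Let the form attain its maximal modulus m at u₀, and let c be a nearby net point. The values at
u₀ and c differ by ⟨S(u₀ - c), u₀ + c⟩, of modulus at most m·(1/4)·2, so m ≤ δ + m/2. -/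
theorem abs_inner_apply_self_le_of_net {E : Type*} [NormedAddCommGroup E] [InnerProductSpace ℝ E]
    [FiniteDimensional ℝ E] {S : E →L[ℝ] E} (hS : ∀ x y, inner ℝ (S x) y = inner ℝ x (S y))
    {s : Set E} (hs : ∀ u : E, ‖u‖ = 1 → ∃ c ∈ s, ‖u - c‖ ≤ 1 / 4) (hs1 : ∀ c ∈ s, ‖c‖ = 1)
    {δ : ℝ} (h : ∀ c ∈ s, |inner ℝ (S c) c| ≤ δ) {u : E} (hu : ‖u‖ = 1) :
    |inner ℝ (S u) u| ≤ 2 * δ := by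
  obtain ⟨u₀, hu₀, hmax⟩ := (isCompact_sphere (0 : E) 1).exists_isMaxOn ⟨u, by simpa using hu⟩
    (f := fun x => |inner ℝ (S x) x|) (by fun_prop)
  have hu₀1 : ‖u₀‖ = 1 := by simpa using hu₀
  set m := |inner ℝ (S u₀) u₀| with hm
  have hm0 : 0 ≤ m := abs_nonneg _
  have hq : ∀ x : E, |inner ℝ (S x) x| ≤ m * ‖x‖ ^ 2 := fun x => by
    rcases eq_or_ne x 0 with rfl | hx
    · simp
    · have hx0 : ‖x‖ ≠ 0 := norm_ne_zero_iff.mpr hx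
      have h1 : |inner ℝ (S (‖x‖⁻¹ • x)) (‖x‖⁻¹ • x)| ≤ m :=
        hmax (by simp [norm_smul, hx0])
      have h2 : inner ℝ (S x) x = ‖x‖ ^ 2 * inner ℝ (S (‖x‖⁻¹ • x)) (‖x‖⁻¹ • x) := by
        rw [map_smul, real_inner_smul_left, real_inner_smul_right]
        field_simp
      rw [h2, abs_mul, abs_of_nonneg (sq_nonneg _), mul_comm]
      gcongr
  obtain ⟨c, hc, hcu⟩ := hs u₀ hu₀1
  have hbil : |inner ℝ (S (u₀ - c)) (u₀ + c)| ≤ m / 2 := by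
    -- Scaling by 8 brings both vectors to norm at most 2; polarisation and the parallelogram law
    -- then bound the bilinear form by m alone.
    set x := (8 : ℝ) • (u₀ - c) with hx
    set y := u₀ + c
    have hxn : ‖x‖ ^ 2 ≤ 4 := by
      have : ‖x‖ ≤ 2 := by rw [hx, norm_smul, Real.norm_eq_abs]; norm_num; linarith
      nlinarith [norm_nonneg x]
    have hyn : ‖y‖ ^ 2 ≤ 4 := by
      have : ‖y‖ ≤ 2 := (norm_add_le _ _).trans (by rw [hu₀1, hs1 c hc]; norm_num)
      nlinarith [norm_nonneg y]
    have hpar := parallelogram_law_with_norm ℝ x y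
    have hpol : 4 * inner ℝ (S x) y =
        inner ℝ (S (x + y)) (x + y) - inner ℝ (S (x - y)) (x - y) := by
      simp only [map_add, map_sub, inner_add_left, inner_add_right, inner_sub_left,
        inner_sub_right, hS y x, real_inner_comm (S x) y]
      ring
    have hSx : inner ℝ (S x) y = 8 * inner ℝ (S (u₀ - c)) y := by
      rw [hx, map_smul, real_inner_smul_left]
    have h1 := abs_le.mp (hq (x + y))
    have h2 := abs_le.mp (hq (x - y))
    have h3 : m * (‖x + y‖ ^ 2 + ‖x - y‖ ^ 2) ≤ m * 16 := by
      gcongr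
      nlinarith
    rw [abs_le]
    constructor <;> linarith [h1.1, h1.2, h2.1, h2.2]
  have hdiff : inner ℝ (S u₀) u₀ - inner ℝ (S c) c = inner ℝ (S (u₀ - c)) (u₀ + c) := by
    rw [map_sub, inner_sub_left, inner_add_right, inner_add_right, hS u₀ c, real_inner_comm u₀ (S c)]
    ring
  have hmu : |inner ℝ (S u) u| ≤ m := hmax (by simpa using hu)
  have := h c hc
  have h3 : m ≤ |inner ℝ (S c) c| + |inner ℝ (S (u₀ - c)) (u₀ + c)| := by
    rw [hm, show inner ℝ (S u₀) u₀ = inner ℝ (S c) c + inner ℝ (S (u₀ - c)) (u₀ + c) by linarith]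
    exact abs_add_le _ _
  linarith

theorem inner_toEuclideanCLM_comm {n : Type*} [Fintype n] [DecidableEq n] (P : Matrix n n ℝ)
    (x y : EuclideanSpace ℝ n) :
    inner ℝ (Matrix.toEuclideanCLM (𝕜 := ℝ) P x) y =
      inner ℝ x (Matrix.toEuclideanCLM (𝕜 := ℝ) P.transpose y) := by
  rw [real_inner_comm, Matrix.inner_toEuclideanCLM, Matrix.inner_toEuclideanCLM,
    Matrix.mulVec_transpose, Matrix.dotProduct_mulVec, dotProduct_comm]

theorem norm_toEuclideanCLM_transpose {n : Type*} [Fintype n] [DecidableEq n] (P : Matrix n n ℝ) :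
    ‖Matrix.toEuclideanCLM (n := n) (𝕜 := ℝ) P.transpose‖ = euclideanOpNorm P := by
  rw [euclideanOpNorm, ← Matrix.conjTranspose_eq_transpose_of_trivial,
    ← Matrix.star_eq_conjTranspose, map_star, ContinuousLinearMap.star_eq_adjoint,
    LinearIsometryEquiv.norm_map]

theorem norm_toEuclideanCLM_transpose_sq {n : Type*} [Fintype n] [DecidableEq n]
    (P : Matrix n n ℝ) (x : EuclideanSpace ℝ n) :
    ‖Matrix.toEuclideanCLM (𝕜 := ℝ) P.transpose x‖ ^ 2 =
      inner ℝ x (Matrix.toEuclideanCLM (𝕜 := ℝ) (P * P.transpose) x) := by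
  rw [← real_inner_self_eq_norm_sq, inner_toEuclideanCLM_comm, Matrix.transpose_transpose, map_mul]
  rfl

theorem lambdaMin_mul_le_inner {n : Type*} [Fintype n] [DecidableEq n] {P : Matrix n n ℝ}
    (hP : P.IsHermitian) (x : EuclideanSpace ℝ n) :
    lambdaMin hP * ‖x‖ ^ 2 ≤ inner ℝ x (Matrix.toEuclideanCLM (𝕜 := ℝ) P x) := by
  rw [Matrix.inner_toEuclideanCLM, hP.dotProduct_mulVec_eq_sum_eigenvalues,
    ← hP.eigenvectorBasis.sum_sq_norm_inner_right x, Finset.mul_sum]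
  refine Finset.sum_le_sum fun k _ => ?_
  rw [Real.norm_eq_abs, sq_abs]
  gcongr
  exact ciInf_le (Set.finite_range _).bddBelow k

theorem inner_le_lambdaMax_mul {n : Type*} [Fintype n] [DecidableEq n] {P : Matrix n n ℝ}
    (hP : P.IsHermitian) (x : EuclideanSpace ℝ n) :
    inner ℝ x (Matrix.toEuclideanCLM (𝕜 := ℝ) P x) ≤ lambdaMax hP * ‖x‖ ^ 2 := by
  rw [Matrix.inner_toEuclideanCLM, hP.dotProduct_mulVec_eq_sum_eigenvalues,
    ← hP.eigenvectorBasis.sum_sq_norm_inner_right x, Finset.mul_sum]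
  refine Finset.sum_le_sum fun k _ => ?_
  rw [Real.norm_eq_abs, sq_abs]
  gcongr
  exact le_ciSup (Set.finite_range _).bddAbove k

theorem eigenvalues_eq_inner {n : Type*} [Fintype n] [DecidableEq n] {P : Matrix n n ℝ}
    (hP : P.IsHermitian) (i : n) : hP.eigenvalues i = inner ℝ (hP.eigenvectorBasis i)
      (Matrix.toEuclideanCLM (𝕜 := ℝ) P (hP.eigenvectorBasis i)) := by
  rw [Matrix.inner_toEuclideanCLM, hP.mulVec_eigenvectorBasis, dotProduct_smul]
  have := hP.eigenvectorBasis.orthonormal.1 i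
  have h2 := real_inner_self_eq_norm_sq (hP.eigenvectorBasis i)
  rw [this, EuclideanSpace.inner_eq_star_dotProduct] at h2
  simp at h2
  simp [h2]

/-- If the quadratic forms of `P` and `Q` agree up to the relative error `max ε ε²`, then the
eigenvalues of `P` are controlled by the extreme eigenvalues of `Q`. -/
theorem eigenvalues_mem_of_abs_inner_sub_le {n : Type*} [Fintype n] [DecidableEq n]
    {P Q : Matrix n n ℝ} (hP : P.PosSemidef) (hQ : Q.PosSemidef) {ε : ℝ} (hε : 0 < ε)
    (h : ∀ x : EuclideanSpace ℝ n, |inner ℝ x (Matrix.toEuclideanCLM (𝕜 := ℝ) P x) -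
      inner ℝ x (Matrix.toEuclideanCLM (𝕜 := ℝ) Q x)| ≤
        max ε (ε ^ 2) * inner ℝ x (Matrix.toEuclideanCLM (𝕜 := ℝ) Q x)) (i : n) :
    (max (1 - ε) 0) ^ 2 * lambdaMin hQ.isHermitian ≤ hP.isHermitian.eigenvalues i ∧
      hP.isHermitian.eigenvalues i ≤ (1 + ε) ^ 2 * lambdaMax hQ.isHermitian := by
  set x := hP.isHermitian.eigenvectorBasis i
  have hx : ‖x‖ = 1 := hP.isHermitian.eigenvectorBasis.orthonormal.1 i
  have hmin := lambdaMin_mul_le_inner hQ.isHermitian x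
  have hmax := inner_le_lambdaMax_mul hQ.isHermitian x
  have hev := eigenvalues_eq_inner hP.isHermitian i
  have h0 := hP.eigenvalues_nonneg i
  have hq0 : 0 ≤ inner ℝ x (Matrix.toEuclideanCLM (𝕜 := ℝ) Q x) := by
    rw [Matrix.inner_toEuclideanCLM]
    simpa using hQ.dotProduct_mulVec_nonneg x.ofLp
  have hd := h x
  rw [← hev] at hd
  rw [hx, one_pow, mul_one] at hmin hmax
  obtain ⟨h1, h2⟩ := abs_le.mp hd
  set q := inner ℝ x (Matrix.toEuclideanCLM (𝕜 := ℝ) Q x)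
  constructor
  · rcases le_total ε 1 with h3 | h3
    · rw [max_eq_left (by linarith)]
      rw [max_eq_left (by nlinarith)] at h1
      calc (1 - ε) ^ 2 * lambdaMin hQ.isHermitian ≤ (1 - ε) ^ 2 * q := by gcongr
        _ ≤ (1 - ε) * q := by gcongr; nlinarith
        _ ≤ _ := by linarith
    · rw [max_eq_right (by linarith)]
      simpa using h0
  · have h4 : 1 + max ε (ε ^ 2) ≤ (1 + ε) ^ 2 := by
      rcases max_choice ε (ε ^ 2) with h5 | h5 <;> rw [h5] <;> nlinarith
    calc hP.isHermitian.eigenvalues i ≤ (1 + max ε (ε ^ 2)) * q := by linarith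
      _ ≤ (1 + ε) ^ 2 * q := by gcongr
      _ ≤ _ := by gcongr

/-! ### The linear system and its noise weights. -/

section LinearSystem

variable {d : ℕ}

theorem inner_gammaMatrix (A : Matrix (Fin d) (Fin d) ℝ) (T : ℕ) (x : EuclideanSpace ℝ (Fin d)) :
    inner ℝ x (Matrix.toEuclideanCLM (𝕜 := ℝ) (gammaMatrix A T) x) =
      ∑ t ∈ Finset.Icc 1 T, ∑ k ∈ Finset.range t,
        ‖Matrix.toEuclideanCLM (𝕜 := ℝ) (A ^ k).transpose x‖ ^ 2 := by
  simp_rw [norm_toEuclideanCLM_transpose_sq, gammaMatrix, map_sum, sum_apply,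
    inner_sum, Matrix.transpose_pow]

theorem inner_empiricalGram (X : ℕ → EuclideanSpace ℝ (Fin d)) (T : ℕ)
    (x : EuclideanSpace ℝ (Fin d)) :
    inner ℝ x (Matrix.toEuclideanCLM (𝕜 := ℝ) (empiricalGram X T) x) =
      ∑ t ∈ Finset.Icc 1 T, inner ℝ x (X t) ^ 2 := by
  rw [Matrix.inner_toEuclideanCLM, empiricalGram, Matrix.sum_mulVec, dotProduct_sum]
  refine Finset.sum_congr rfl fun t _ => ?_
  rw [EuclideanSpace.inner_eq_star_dotProduct]
  simp [Matrix.vecMulVec_mulVec, sq, dotProduct_comm]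

theorem empiricalGram_posSemidef (X : ℕ → EuclideanSpace ℝ (Fin d)) (T : ℕ) :
    (empiricalGram X T).PosSemidef := by
  refine Matrix.PosSemidef.of_dotProduct_mulVec_nonneg (empiricalGram_isHermitian X T) fun x => ?_
  have h := inner_empiricalGram X T (WithLp.toLp 2 x)
  rw [Matrix.inner_toEuclideanCLM] at h
  simp only [star_trivial, h]
  positivity

theorem gammaMatrix_posDef (A : Matrix (Fin d) (Fin d) ℝ) {T : ℕ} (hT : 1 ≤ T) :
    (gammaMatrix A T).PosDef := by
  refine Matrix.PosDef.of_dotProduct_mulVec_pos (gammaMatrix_isHermitian A T) fun x hx => ?_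
  have h := inner_gammaMatrix A T (WithLp.toLp 2 x)
  rw [Matrix.inner_toEuclideanCLM] at h
  simp only [star_trivial, h]
  -- The summand t = 1, k = 0 is ‖x‖².
  refine Finset.sum_pos' (fun t _ => by positivity) ⟨1, by simpa using hT, ?_⟩
  have : WithLp.toLp 2 x ≠ 0 := by simpa using hx
  simpa using pow_pos (norm_pos_iff.mpr this) 2

theorem invSqrtGamma_isHermitian (A : Matrix (Fin d) (Fin d) ℝ) (T : ℕ) :
    (invSqrtGamma A T).IsHermitian := cfc_predicate (p := IsSelfAdjoint) _ _

theorem invSqrtGamma_mul_gamma_mul (A : Matrix (Fin d) (Fin d) ℝ) {T : ℕ} (hT : 1 ≤ T) :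
    invSqrtGamma A T * gammaMatrix A T * invSqrtGamma A T = 1 := by
  have hG := gammaMatrix_isHermitian A T
  have hsa : IsSelfAdjoint (gammaMatrix A T) := hG
  -- The power -1/2 is continuous only away from 0, so the functional calculus needs a positive
  -- spectrum.
  have hpos : ∀ x ∈ spectrum ℝ (gammaMatrix A T), 0 < x := fun x hx => by
    rw [hG.spectrum_real_eq_range_eigenvalues] at hx
    obtain ⟨i, rfl⟩ := hx
    exact (gammaMatrix_posDef A hT).eigenvalues_pos i
  have hc : ContinuousOn (fun x : ℝ => x ^ (-(1 / 2) : ℝ)) (spectrum ℝ (gammaMatrix A T)) :=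
    fun x hx => (Real.continuousAt_rpow_const _ _ (Or.inl (hpos x hx).ne')).continuousWithinAt
  have hid : gammaMatrix A T = cfc (fun x : ℝ => x) (gammaMatrix A T) := (cfc_id' ℝ _).symm
  calc invSqrtGamma A T * gammaMatrix A T * invSqrtGamma A T
      = invSqrtGamma A T * cfc (fun x : ℝ => x) (gammaMatrix A T) * invSqrtGamma A T := by
        rw [← hid]
    _ = cfc (fun x : ℝ => x ^ (-(1 / 2) : ℝ) * x * x ^ (-(1 / 2) : ℝ)) (gammaMatrix A T) := by
        rw [invSqrtGamma, ← cfc_mul _ _ _ hc (continuousOn_id' _),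
          ← cfc_mul (fun x : ℝ => x ^ (-(1 / 2) : ℝ) * x) _ _ (hc.mul (continuousOn_id' _)) hc]
    _ = cfc (fun _ : ℝ => 1) (gammaMatrix A T) := by
        refine cfc_congr fun x hx => ?_
        have hx0 := hpos x hx
        have h1 : x ^ (-(1 / 2) : ℝ) * x ^ (-(1 / 2) : ℝ) = x⁻¹ := by
          rw [← Real.rpow_add hx0, ← Real.rpow_neg_one]; norm_num
        calc _ = x * (x ^ (-(1 / 2) : ℝ) * x ^ (-(1 / 2) : ℝ)) := by ring
          _ = 1 := by rw [h1, mul_inv_cancel₀ hx0.ne']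
    _ = 1 := cfc_const_one ℝ _

/-- The vectors `(A^{t-s})ᵀ v` for `s ≤ t`, through which `⟨v, X_{t+1}⟩` depends on the noise. -/
noncomputable def noiseWeight (A : Matrix (Fin d) (Fin d) ℝ) (T : ℕ)
    (v : EuclideanSpace ℝ (Fin d)) (t s : Fin T) : EuclideanSpace ℝ (Fin d) :=
  if s ≤ t then Matrix.toEuclideanCLM (𝕜 := ℝ) (A ^ ((t : ℕ) - (s : ℕ))).transpose v else 0

theorem sum_norm_sum_noiseWeight_le (A : Matrix (Fin d) (Fin d) ℝ) (T : ℕ)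
    (v : EuclideanSpace ℝ (Fin d)) (g : Fin T → ℝ) :
    ∑ s, ‖∑ t, g t • noiseWeight A T v t s‖ ^ 2 ≤
      ‖v‖ ^ 2 * euclideanOpNorm (noiseToState A T) ^ 2 * ∑ t, g t ^ 2 := by
  -- For y = g ⊗ v, block s of Lᵀy is ∑_t g_t b_ts, so the claim is the operator norm bound for Lᵀ.
  set y : EuclideanSpace ℝ (Fin T × Fin d) := WithLp.toLp 2 fun p => g p.1 * v p.2 with hy
  have hyn : ‖y‖ ^ 2 = ‖v‖ ^ 2 * ∑ t, g t ^ 2 := by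
    rw [EuclideanSpace.real_norm_sq_eq, EuclideanSpace.real_norm_sq_eq, Fintype.sum_prod_type,
      mul_comm, Finset.sum_mul_sum]
    simp [hy, mul_pow]
  have hL : ‖Matrix.toEuclideanCLM (𝕜 := ℝ) (noiseToState A T).transpose y‖ ^ 2 =
      ∑ s, ‖∑ t, g t • noiseWeight A T v t s‖ ^ 2 := by
    rw [EuclideanSpace.real_norm_sq_eq, Fintype.sum_prod_type]
    refine Finset.sum_congr rfl fun s _ => ?_
    rw [EuclideanSpace.real_norm_sq_eq]
    refine Finset.sum_congr rfl fun j _ => ?_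
    congr 1
    rw [Matrix.ofLp_toEuclideanCLM, WithLp.ofLp_sum, Finset.sum_apply]
    simp only [Matrix.mulVec, dotProduct, Fintype.sum_prod_type, Matrix.transpose_apply,
      noiseToState, hy]
    refine Finset.sum_congr rfl fun t _ => ?_
    by_cases hst : s ≤ t
    · simp only [noiseWeight, hst, if_true, PiLp.smul_apply, Matrix.ofLp_toEuclideanCLM,
        Matrix.mulVec, dotProduct, Matrix.transpose_apply, smul_eq_mul, Finset.mul_sum]
      exact Finset.sum_congr rfl fun i _ => by ring
    · simp [noiseWeight, hst]
  rw [← hL]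
  calc ‖Matrix.toEuclideanCLM (𝕜 := ℝ) (noiseToState A T).transpose y‖ ^ 2
      ≤ (euclideanOpNorm (noiseToState A T) * ‖y‖) ^ 2 := by
        gcongr
        rw [← norm_toEuclideanCLM_transpose]
        exact ContinuousLinearMap.le_opNorm _ _
    _ = _ := by rw [mul_pow, hyn]; ring

theorem norm_noiseWeight_sq (A : Matrix (Fin d) (Fin d) ℝ) (T : ℕ)
    (v : EuclideanSpace ℝ (Fin d)) (t s : Fin T) : ‖noiseWeight A T v t s‖ ^ 2 =
      if (s : ℕ) ≤ t then ‖Matrix.toEuclideanCLM (𝕜 := ℝ) (A ^ ((t : ℕ) - (s : ℕ))).transpose v‖ ^ 2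
        else 0 := by
  rw [noiseWeight]
  simp only [Fin.le_def]
  split_ifs <;> simp

theorem sum_range_ite_le_eq {M : Type*} [AddCommMonoid M] (f : ℕ → M) {t T : ℕ} (ht : t < T) :
    ∑ s ∈ Finset.range T, (if s ≤ t then f (t - s) else 0) = ∑ k ∈ Finset.range (t + 1), f k := by
  rw [← Finset.sum_filter, ← Finset.sum_range_reflect]
  refine Finset.sum_congr ?_ fun s _ => by simp
  ext s; simp; omega

theorem sum_norm_noiseWeight (A : Matrix (Fin d) (Fin d) ℝ) (T : ℕ)
    (v : EuclideanSpace ℝ (Fin d)) : ∑ t, ∑ s, ‖noiseWeight A T v t s‖ ^ 2 =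
      inner ℝ v (Matrix.toEuclideanCLM (𝕜 := ℝ) (gammaMatrix A T) v) := by
  rw [inner_gammaMatrix]
  simp_rw [norm_noiseWeight_sq]
  rw [show Finset.Icc 1 T = Finset.Ico 1 (T + 1) from rfl, Finset.sum_Ico_eq_sum_range,
    Nat.add_sub_cancel, ← Fin.sum_univ_eq_sum_range fun t => ∑ k ∈ Finset.range (1 + t),
      ‖Matrix.toEuclideanCLM (𝕜 := ℝ) (A ^ k).transpose v‖ ^ 2]
  refine Finset.sum_congr rfl fun t _ => ?_
  rw [Fin.sum_univ_eq_sum_range (fun s => if s ≤ (t : ℕ) then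
    ‖Matrix.toEuclideanCLM (𝕜 := ℝ) (A ^ ((t : ℕ) - s)).transpose v‖ ^ 2 else 0),
    sum_range_ite_le_eq (fun k => ‖Matrix.toEuclideanCLM (𝕜 := ℝ) (A ^ k).transpose v‖ ^ 2) t.2,
    add_comm]

/-- By the Toeplitz structure the norms in any column all occur in the last row, which the preceding
operator norm estimate bounds when g is the last unit vector. -/
theorem sum_norm_noiseWeight_col_le (A : Matrix (Fin d) (Fin d) ℝ) (T : ℕ)
    (v : EuclideanSpace ℝ (Fin d)) (s : Fin T) : ∑ t, ‖noiseWeight A T v t s‖ ^ 2 ≤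
      ‖v‖ ^ 2 * euclideanOpNorm (noiseToState A T) ^ 2 := by
  set f : ℕ → ℝ := fun k => ‖Matrix.toEuclideanCLM (𝕜 := ℝ) (A ^ k).transpose v‖ ^ 2
  obtain ⟨n, rfl⟩ : ∃ n, T = n + 1 := ⟨T - 1, by have := s.pos; omega⟩
  have hrow := sum_norm_sum_noiseWeight_le A (n + 1) v (Pi.single (Fin.last n) 1)
  simp only [Pi.single_apply, ite_smul, one_smul, zero_smul, Finset.sum_ite_eq', Finset.mem_univ,
    if_true, ite_pow, one_pow, ne_eq, OfNat.ofNat_ne_zero, not_false_eq_true, zero_pow,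
    mul_one] at hrow
  refine le_trans ?_ hrow
  simp_rw [norm_noiseWeight_sq]
  rw [Fin.sum_univ_eq_sum_range (fun t => if (s : ℕ) ≤ t then f (t - s) else 0),
    Fin.sum_univ_eq_sum_range (fun s => if s ≤ (Fin.last n : ℕ) then f (Fin.last n - s) else 0),
    sum_range_ite_le_eq f (by simp), ← Finset.sum_filter,
    show (Finset.range (n + 1)).filter (fun t => (s : ℕ) ≤ t) = Finset.Ico (s : ℕ) (n + 1) by
      ext t; simp; omega, Finset.sum_Ico_eq_sum_range]
  simp only [Nat.add_sub_cancel_left]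
  refine Finset.sum_le_sum_of_subset_of_nonneg (by intro k; simp; omega) fun k _ _ => by positivity

/-- The state is the response of the linear system to the past noise. -/
theorem state_eq_sum {A : Matrix (Fin d) (Fin d) ℝ} {T : ℕ} {w x : ℕ → EuclideanSpace ℝ (Fin d)}
    (hx0 : x 0 = 0) (hx : ∀ t < T, x (t + 1) = Matrix.toEuclideanCLM (𝕜 := ℝ) A (x t) + w t) :
    ∀ t ≤ T, x t = ∑ s ∈ Finset.range t, Matrix.toEuclideanCLM (𝕜 := ℝ) (A ^ (t - 1 - s)) (w s)
  | 0, _ => by simp [hx0]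
  | t + 1, ht => by
    rw [hx t ht, state_eq_sum hx0 hx t (by omega), Finset.sum_range_succ, map_sum]
    congr 1
    · refine Finset.sum_congr rfl fun s hs => ?_
      have hs' := Finset.mem_range.mp hs
      rw [show t + 1 - 1 - s = (t - 1 - s) + 1 by omega, pow_succ', map_mul]
      rfl
    · simp

theorem inner_state_eq_sum_noiseWeight {A : Matrix (Fin d) (Fin d) ℝ} {T : ℕ}
    {w x : ℕ → EuclideanSpace ℝ (Fin d)} (hx0 : x 0 = 0)
    (hx : ∀ t < T, x (t + 1) = Matrix.toEuclideanCLM (𝕜 := ℝ) A (x t) + w t)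
    (v : EuclideanSpace ℝ (Fin d)) (t : Fin T) :
    inner ℝ v (x (t + 1)) = ∑ s : Fin T, inner ℝ (noiseWeight A T v t s) (w s) := by
  rw [state_eq_sum hx0 hx (t + 1) (by omega), inner_sum]
  have h : ∀ s : Fin T, inner ℝ (noiseWeight A T v t s) (w s) =
      if (s : ℕ) ≤ t then inner ℝ v (Matrix.toEuclideanCLM (𝕜 := ℝ) (A ^ ((t : ℕ) - s)) (w s))
        else 0 := fun s => by
    rw [noiseWeight]
    simp only [Fin.le_def]
    split_ifs
    · rw [inner_toEuclideanCLM_comm, Matrix.transpose_transpose]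
    · simp
  simp_rw [h]
  rw [Fin.sum_univ_eq_sum_range (fun s => if s ≤ (t : ℕ) then
    inner ℝ v (Matrix.toEuclideanCLM (𝕜 := ℝ) (A ^ ((t : ℕ) - s)) (w s)) else 0),
    ← Finset.sum_filter]
  refine Finset.sum_congr ?_ fun s _ => by simp
  ext s; simp; omega

end LinearSystem

/-! ### Whitening by `M` and conclusion. -/

theorem inner_toEuclideanCLM_conj {n : Type*} [Fintype n] [DecidableEq n] {M : Matrix n n ℝ}
    (hM : M.IsHermitian) (P : Matrix n n ℝ) (u : EuclideanSpace ℝ n) :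
    inner ℝ (Matrix.toEuclideanCLM (𝕜 := ℝ) M u)
      (Matrix.toEuclideanCLM (𝕜 := ℝ) P (Matrix.toEuclideanCLM (𝕜 := ℝ) M u)) =
      inner ℝ u (Matrix.toEuclideanCLM (𝕜 := ℝ) (M * P * M) u) := by
  have hMt : M.transpose = M := by
    rw [← Matrix.conjTranspose_eq_transpose_of_trivial]; exact hM
  rw [inner_toEuclideanCLM_comm, hMt, map_mul, map_mul]
  rfl

/-- If `M Q M = 1`, then control of the quadratic form of `M P M - 1` on a quarter-net of the unit
sphere compares the quadratic forms of `P` and `Q`. -/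
theorem abs_inner_sub_inner_le_of_net {n : Type*} [Fintype n] [DecidableEq n]
    {M P Q : Matrix n n ℝ} (hM : M.IsHermitian) (hP : P.IsHermitian) (hMQ : M * Q * M = 1)
    {s : Set (EuclideanSpace ℝ n)}
    (hs : ∀ u : EuclideanSpace ℝ n, ‖u‖ = 1 → ∃ c ∈ s, ‖u - c‖ ≤ 1 / 4)
    (hs1 : ∀ c ∈ s, ‖c‖ = 1) {m : ℝ}
    (h : ∀ c ∈ s, |inner ℝ (Matrix.toEuclideanCLM (𝕜 := ℝ) M c)
      (Matrix.toEuclideanCLM (𝕜 := ℝ) P (Matrix.toEuclideanCLM (𝕜 := ℝ) M c)) - 1| ≤ m / 2)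
    (x : EuclideanSpace ℝ n) :
    |inner ℝ x (Matrix.toEuclideanCLM (𝕜 := ℝ) P x) -
      inner ℝ x (Matrix.toEuclideanCLM (𝕜 := ℝ) Q x)| ≤
        m * inner ℝ x (Matrix.toEuclideanCLM (𝕜 := ℝ) Q x) := by
  set S := Matrix.toEuclideanCLM (n := n) (𝕜 := ℝ) (M * P * M - 1) with hS
  have hSH : (M * P * M - 1).transpose = M * P * M - 1 := by
    have e1 : M.transpose = M := by
      rw [← Matrix.conjTranspose_eq_transpose_of_trivial]; exact hM
    have e2 : P.transpose = P := by
      rw [← Matrix.conjTranspose_eq_transpose_of_trivial]; exact hP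
    simp [Matrix.transpose_mul, e1, e2, Matrix.mul_assoc]
  have hSsym : ∀ x y, inner ℝ (S x) y = inner ℝ x (S y) := fun x y => by
    rw [hS, inner_toEuclideanCLM_comm, hSH]
  have hSq : ∀ u, inner ℝ (S u) u = inner ℝ (Matrix.toEuclideanCLM (𝕜 := ℝ) M u)
      (Matrix.toEuclideanCLM (𝕜 := ℝ) P (Matrix.toEuclideanCLM (𝕜 := ℝ) M u)) - ‖u‖ ^ 2 :=
    fun u => by
      rw [hSsym, inner_toEuclideanCLM_conj hM, hS, map_sub, map_one,
        sub_apply, inner_sub_right, one_apply_eq_self,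
        real_inner_self_eq_norm_sq]
  have hunit : ∀ u, ‖u‖ = 1 → |inner ℝ (S u) u| ≤ m := fun u hu => by
    have := abs_inner_apply_self_le_of_net hSsym hs hs1 (δ := m / 2) (fun c hc => by
      rw [hSq, hs1 c hc, one_pow]; exact h c hc) hu
    linarith
  have hall : ∀ u, |inner ℝ (S u) u| ≤ m * ‖u‖ ^ 2 := fun u => by
    rcases eq_or_ne u 0 with rfl | hu
    · simp
    · have hu0 : ‖u‖ ≠ 0 := norm_ne_zero_iff.mpr hu
      have h1 := hunit (‖u‖⁻¹ • u) (by simp [norm_smul, hu0])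
      have h2 : inner ℝ (S u) u = ‖u‖ ^ 2 * inner ℝ (S (‖u‖⁻¹ • u)) (‖u‖⁻¹ • u) := by
        rw [map_smul, real_inner_smul_left, real_inner_smul_right]
        field_simp
      rw [h2, abs_mul, abs_of_nonneg (sq_nonneg _), mul_comm]
      gcongr
  have hMQ' : M * (Q * M) = 1 := by rw [← Matrix.mul_assoc, hMQ]
  -- Since M(QM) = 1, this u is the preimage of x under M, and the form of Q at x equals ‖u‖².
  set u := Matrix.toEuclideanCLM (𝕜 := ℝ) (Q * M) x with hu
  have hx : Matrix.toEuclideanCLM (𝕜 := ℝ) M u = x := by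
    have : Matrix.toEuclideanCLM (𝕜 := ℝ) (M * (Q * M)) x = x := by rw [hMQ', map_one]; rfl
    rwa [map_mul] at this
  have hQx : inner ℝ x (Matrix.toEuclideanCLM (𝕜 := ℝ) Q x) = ‖u‖ ^ 2 := by
    rw [← hx, inner_toEuclideanCLM_conj hM, hMQ, map_one, one_apply_eq_self,
      real_inner_self_eq_norm_sq]
  have := hall u
  rwa [hSq, hx, ← hQx] at this

theorem inner_empiricalGram_eq_sum_noiseWeight {d : ℕ} {A : Matrix (Fin d) (Fin d) ℝ} {T : ℕ}
    {w x : ℕ → EuclideanSpace ℝ (Fin d)} (hx0 : x 0 = 0)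
    (hx : ∀ t < T, x (t + 1) = Matrix.toEuclideanCLM (𝕜 := ℝ) A (x t) + w t)
    (v : EuclideanSpace ℝ (Fin d)) :
    inner ℝ v (Matrix.toEuclideanCLM (𝕜 := ℝ) (empiricalGram x T) v) =
      ∑ t : Fin T, (∑ s : Fin T, inner ℝ (noiseWeight A T v t s) (w s)) ^ 2 := by
  simp_rw [← inner_state_eq_sum_noiseWeight hx0 hx v]
  rw [inner_empiricalGram, show Finset.Icc 1 T = Finset.Ico 1 (T + 1) from rfl,
    Finset.sum_Ico_eq_sum_range, Nat.add_sub_cancel,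
    Fin.sum_univ_eq_sum_range fun t => inner ℝ v (x (t + 1)) ^ 2]
  simp_rw [add_comm]

theorem mainTheorem9 {Ω : Type*} [MeasurableSpace Ω] (μ : Measure Ω) [IsProbabilityMeasure μ]
    (d T : ℕ) (hT : 1 ≤ T) (K : ℝ)
    (A : Matrix (Fin d) (Fin d) ℝ) (hA : IsStableMatrix A)
    (W X : ℕ → Ω → EuclideanSpace ℝ (Fin d))
    (hWmeas : ∀ t < T, Measurable (W t))
    (hWindep : iIndepFun (fun t : Fin T => W t) μ)
    (hWident : ∀ s < T, ∀ t < T, IdentDistrib (W s) (W t) μ μ)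
    (hWiso : ∀ t < T, IsIsotropicVector (W t) μ)
    (hWsubG : ∀ t < T, IsSubGaussianVector (W t) (K ^ 2) μ)
    (hX0 : ∀ ω, X 0 ω = 0)
    (hX : ∀ t < T, ∀ ω, X (t + 1) ω = Matrix.toEuclideanCLM (𝕜 := ℝ) A (X t ω) + W t ω)
    (ε : ℝ) (hε : 0 < ε) :
    1 - Real.exp (-(ε ^ 2 / (576 * K ^ 4 * euclideanOpNorm (invSqrtGamma A T) ^ 2 *
          euclideanOpNorm (noiseToState A T) ^ 2)) + d * Real.log 18) ≤
      μ.real {ω | ∀ i : Fin d,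
        (max (1 - ε) 0) ^ 2 * lambdaMin (gammaMatrix_isHermitian A T) ≤
            (empiricalGram_isHermitian (fun t => X t ω) T).eigenvalues i ∧
          (empiricalGram_isHermitian (fun t => X t ω) T).eigenvalues i ≤
            (1 + ε) ^ 2 * lambdaMax (gammaMatrix_isHermitian A T)} := by
  -- In dimension 0 the event is everything; d ≥ 1 is needed for κ ≥ 1 and for 2 ≤ 2^d.
  rcases Nat.eq_zero_or_pos d with rfl | hd
  · have hexp := Real.exp_pos (-(ε ^ 2 / (576 * K ^ 4 * euclideanOpNorm (invSqrtGamma A T) ^ 2 *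
          euclideanOpNorm (noiseToState A T) ^ 2)) + (0 : ℕ) * Real.log 18)
    simp only [IsEmpty.forall_iff, Set.ofPred_true, probReal_univ]
    linarith
  have : NeZero d := ⟨hd.ne'⟩
  have hκ : 1 ≤ K ^ 2 :=
    one_le_of_isSubGaussianVector_of_isIsotropicVector (hWsubG 0 hT) (hWiso 0 hT)
  set M := invSqrtGamma A T with hMdef
  have hM : M.IsHermitian := invSqrtGamma_isHermitian A T
  have hMG : M * gammaMatrix A T * M = 1 := invSqrtGamma_mul_gamma_mul A hT
  set N := euclideanOpNorm M ^ 2 * euclideanOpNorm (noiseToState A T) ^ 2 with hNdef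
  set Z : EuclideanSpace ℝ (Fin d) → Ω → ℝ := fun u ω => ∑ t : Fin T, (∑ s : Fin T,
    inner ℝ (noiseWeight A T (Matrix.toEuclideanCLM (𝕜 := ℝ) M u) t s) (W s ω)) ^ 2 - 1 with hZ
  have hWm : ∀ s : Fin T, Measurable (W s) := fun s => hWmeas s s.2
  have hnorm : ∀ u : EuclideanSpace ℝ (Fin d), ‖u‖ = 1 →
      ‖Matrix.toEuclideanCLM (𝕜 := ℝ) M u‖ ^ 2 * euclideanOpNorm (noiseToState A T) ^ 2 ≤ N :=
    fun u hu => by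
      rw [hNdef]
      gcongr
      have := (Matrix.toEuclideanCLM (n := Fin d) (𝕜 := ℝ) M).le_opNorm u
      rwa [hu, mul_one] at this
  have hone : ∀ u : EuclideanSpace ℝ (Fin d), ‖u‖ = 1 → ∑ t, ∑ s,
      ‖noiseWeight A T (Matrix.toEuclideanCLM (𝕜 := ℝ) M u) t s‖ ^ 2 = 1 := fun u hu => by
    rw [sum_norm_noiseWeight, inner_toEuclideanCLM_conj hM, hMG, map_one,
      one_apply_eq_self, real_inner_self_eq_norm_sq, hu, one_pow]
  have hcol : ∀ u : EuclideanSpace ℝ (Fin d), ‖u‖ = 1 → ∀ s, ∑ t,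
      ‖noiseWeight A T (Matrix.toEuclideanCLM (𝕜 := ℝ) M u) t s‖ ^ 2 ≤ N := fun u hu s =>
    (sum_norm_noiseWeight_col_le A T _ s).trans (hnorm u hu)
  have hN0 : 0 < N := by
    set u : EuclideanSpace ℝ (Fin d) := EuclideanSpace.single 0 1
    have hu : ‖u‖ = 1 := by simp [u]
    have h1 := hone u hu
    rw [Finset.sum_comm] at h1
    -- If N ≤ 0, all column sums would be nonpositive, yet they add up to 1.
    by_contra! hle
    have := Finset.sum_nonpos fun s (_ : s ∈ Finset.univ) => (hcol u hu s).trans hle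
    linarith
  have htail : ∀ u : EuclideanSpace ℝ (Fin d), ‖u‖ = 1 →
      μ.real {ω | max ε (ε ^ 2) / 2 ≤ |Z u ω|} ≤
        2 * Real.exp (-(ε ^ 2 / (576 * ((K ^ 2) ^ 2 * N)))) := fun u hu => by
    refine ENNReal.toReal_le_of_le_ofReal (by positivity) (meas_abs_ge_le_of_lintegral_exp_le
      (by fun_prop) (by positivity) (fun l hl => ?_) hε)
    exact lintegral_exp_centered_sum_sq_le hWm hWindep hκ (fun s => hWsubG s s.2)
      (fun s => hWiso s s.2) _ (fun g => (sum_norm_sum_noiseWeight_le A T _ g).trans (by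
        gcongr; exact hnorm u hu)) (hcol u hu) (hone u hu) hl
  obtain ⟨s, hs1, hscard, hs⟩ := exists_quarter_net_sphere (E := EuclideanSpace ℝ (Fin d))
  rw [finrank_euclideanSpace_fin] at hscard
  set good := {ω | ∀ i : Fin d,
        (max (1 - ε) 0) ^ 2 * lambdaMin (gammaMatrix_isHermitian A T) ≤
            (empiricalGram_isHermitian (fun t => X t ω) T).eigenvalues i ∧
          (empiricalGram_isHermitian (fun t => X t ω) T).eigenvalues i ≤
            (1 + ε) ^ 2 * lambdaMax (gammaMatrix_isHermitian A T)} with hgood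
  have hsub : goodᶜ ⊆ ⋃ c ∈ s, {ω | max ε (ε ^ 2) / 2 ≤ |Z c ω|} := by
    intro ω hω
    by_contra hnot
    simp only [Set.mem_iUnion, Set.mem_ofPred_eq, not_exists, not_le] at hnot
    refine hω fun i => eigenvalues_mem_of_abs_inner_sub_le (empiricalGram_posSemidef _ T)
      (gammaMatrix_posDef A hT).posSemidef hε (fun x => ?_) i
    refine abs_inner_sub_inner_le_of_net hM (empiricalGram_isHermitian _ T) hMG
      (s := (s : Set (EuclideanSpace ℝ (Fin d)))) hs hs1 (fun c hc => ?_) x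
    rw [inner_empiricalGram_eq_sum_noiseWeight (hX0 ω) (fun t ht => hX t ht ω)]
    exact (hnot c hc).le
  have hbad : μ.real goodᶜ ≤ Real.exp (-(ε ^ 2 / (576 * K ^ 4 * euclideanOpNorm M ^ 2 *
      euclideanOpNorm (noiseToState A T) ^ 2)) + d * Real.log 18) := by
    calc μ.real goodᶜ ≤ μ.real (⋃ c ∈ s, {ω | max ε (ε ^ 2) / 2 ≤ |Z c ω|}) :=
          measureReal_mono hsub (measure_ne_top _ _)
      _ ≤ ∑ c ∈ s, μ.real {ω | max ε (ε ^ 2) / 2 ≤ |Z c ω|} :=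
          measureReal_biUnion_finset_le _ _
      _ ≤ ∑ c ∈ s, 2 * Real.exp (-(ε ^ 2 / (576 * ((K ^ 2) ^ 2 * N)))) :=
          Finset.sum_le_sum fun c hc => htail c (hs1 c hc)
      _ = s.card * 2 * Real.exp (-(ε ^ 2 / (576 * ((K ^ 2) ^ 2 * N)))) := by
          rw [Finset.sum_const, nsmul_eq_mul, mul_assoc]
      -- The two-sided factor 2 is enlarged to 2^d, giving 18^d = exp(d log 18).
      _ ≤ 9 ^ d * 2 ^ d * Real.exp (-(ε ^ 2 / (576 * ((K ^ 2) ^ 2 * N)))) := by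
          gcongr
          · exact_mod_cast hscard
          · exact le_self_pow₀ one_le_two hd.ne'
      _ = _ := by
          rw [Real.exp_add, mul_comm (d : ℝ), Real.exp_mul, Real.exp_log (by norm_num),
            Real.rpow_natCast, ← mul_pow, mul_comm]
          norm_num [hNdef]
          ring_nf
  -- Subadditivity suffices here, so measurability of the eigenvalue event is not needed.
  have hunion : 1 ≤ μ.real good + μ.real goodᶜ := by
    rw [← probReal_univ (μ := μ), ← Set.union_compl_self good]
    exact measureReal_union_le _ _
  linarith
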